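/- Let $k\ge 0$ be fixed and, for each $n$, let $p=p(n)\ge 1$ with $p(n)/n\to c_0\in[0,1)$ as $n\to\infty$. For each $n$ let $\mathbf X$ be an $n\times k$ real matrix, of rank $k$ whenever $n>k$; for $j\subseteq\{1,\dots,k\}$ let $\mathbf X_j$ be the submatrix of the columns indexed by $j$, and $k_j=|j|$. Write $f(\cdot\mid \mathbf M,\mathbf\Sigma)$ for the density of the matrix normal law $N_{n\times p}(\mathbf M,\mathbf\Sigma\otimes \mathbf I_n)$ (independent rows with covariance matrix $\mathbf\Sigma$). The data follow the true model $\mathbf Y\sim N_{n\times p}(\mathbf X_{j_*}\mathbf\Theta_*,\mathbf\Sigma_*\otimes \mathbf I_n)$ for some fixed $j_*\subseteq\{1,\dots,k\}$, where the $k_{j_*}\times p$ matrix $\mathbf\Theta_*$ and the positive definite $p\times p$ matrix $\mathbf\Sigma_*$ may depend on $n$. Fix a candidate model $j$ that contains the true one, $j_*\subseteq j$. For each $n$ let $w_j\in(0,1)$ and, for each positive definite $p\times p$ matrix $\mathbf\Sigma$, let $\pi(\cdot\mid\mathbf\Sigma)$ be a (possibly improper) nonnegative measurable density on $\mathbb R^{k_j\times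 p}$ (both $w_j$ and $\pi$ may depend on $n$). Put $\pi_M=\sup_{\mathbf\Theta}\pi(\mathbf\Theta\mid \mathbf I_p)$ and assume 1. $\pi(\mathbf\Theta\mid\mathbf\Sigma)\,|\mathbf\Sigma|^{k_j/2}=\pi(\mathbf\Theta\mathbf\Sigma^{-1/2}\mid \mathbf I_p)$ for all $\mathbf\Theta\in\mathbb R^{k_j\times p}$ and all positive definite $\mathbf\Sigma$; 2. there are $\ell_n\ge 0$ with $\ell_n\to\infty$ and $\displaystyle\sup_{n}\frac{(1-w_j)\,\ell_n^{pk_j/2}}{w_j\,n^{pk_j/2}}\,\pi_M<\infty$; 3. $\displaystyle\liminf_{n\to\infty}\left|\mathbf X_j^\top \mathbf X_j/n\right|>0$, where $|\cdot|$ is the determinant. Let $$f_\pi(\mathbf Y\mid w_j,\mathbf\Theta_0,\mathbf\Sigma_0)=(1-w_j)\int f(\mathbf Y\mid \mathbf X_j\mathbf\Theta,\mathbf\Sigma_0)\,\pi(\mathbf\Theta\mid\mathbf\Sigma_0)\,d\mathbf\Theta+w_j f(\mathbf Y\mid \mathbf X_j\mathbf\Theta_0,\mathbf\Sigma_0)$$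 be the marginal likelihood under the prior $(1-w_j)\pi(\cdot\mid\mathbf\Sigma_0)+w_j\delta_{\mathbf\Theta_0}$, let $\hat{\mathbf\Theta}_j=(\mathbf X_j^\top \mathbf X_j)^{-1}\mathbf X_j^\top \mathbf Y$ and $\hat{\mathbf\Sigma}_j=\frac1n \mathbf Y^\top(\mathbf I_n-\mathbf X_j(\mathbf X_j^\top \mathbf X_j)^{-1}\mathbf X_j^\top)\mathbf Y$ be the maximum likelihood estimators computed from $\mathbf Y$, and let $\tilde{\mathbf Y}$ be an independent copy of $\mathbf Y$. Then, for all sufficiently large $n$, the expectation $$b_j=E^{\mathbf Y,\tilde{\mathbf Y}}\left[-2\log f_\pi(\tilde{\mathbf Y}\mid w_j,\hat{\mathbf\Theta}_j,\hat{\mathbf\Sigma}_j)+2\log f_\pi(\mathbf Y\mid w_j,\hat{\mathbf\Theta}_j,\hat{\mathbf\Sigma}_j)\right]$$ exists (the random variable is integrable), and $$b_j=\frac{np(2k_j+p+1)}{n-p-k_j-1}+o(p)\qquad(n\to\infty).$$ -/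

import Mathlib

open MeasureTheory Filter Topology Matrix Asymptotics

noncomputable section

namespace MPIC

variable {m ι q : Type*} [Fintype m] [Fintype ι] [Fintype q]

/-- The Borel (product) sigma-algebra on real matrices. -/
instance instMeasurableSpaceMatrix (m q : Type*) : MeasurableSpace (Matrix m q ℝ) :=
  (inferInstance : MeasurableSpace (m → q → ℝ))

/-- Lebesgue measure on the space of real `m × q` matrices. -/
def matVolume (m q : Type*) [Fintype m] [Fintype q] : Measure (Matrix m q ℝ) :=
  (volume : Measure (m → q → ℝ))

/-- The density `f(Y ∣ M, S)` of the matrix normal distribution `N_{m × q}(M, S ⊗ I_m)`: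
the rows of `Y - M` are independent centred Gaussian vectors with covariance matrix `S`. -/
def matNormalPDF [DecidableEq q] (Y M : Matrix m q ℝ) (S : Matrix q q ℝ) : ℝ :=
  (2 * Real.pi) ^ (-((Fintype.card m : ℝ) * (Fintype.card q : ℝ) / 2))
    * S.det ^ (-((Fintype.card m : ℝ) / 2))
    * Real.exp (-(1 / 2) * (S⁻¹ * ((Y - M)ᵀ * (Y - M))).trace)

/-- The matrix normal distribution `N_{m × q}(M, S ⊗ I_m)`, for positive definite `S`. -/
def matNormal [DecidableEq q] (M : Matrix m q ℝ) (S : Matrix q q ℝ) : Measure (Matrix m q ℝ) :=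
  (matVolume m q).withDensity fun Y => ENNReal.ofReal (matNormalPDF Y M S)

/-- The submatrix of `X` made of the columns with index in `j`. -/
def cols {κ : Type*} (X : Matrix m κ ℝ) (j : Finset κ) : Matrix m j ℝ :=
  X.submatrix id Subtype.val

/-- The maximum likelihood estimator `(XᵀX)⁻¹XᵀY` of the regression coefficients. -/
def mleCoef [DecidableEq ι] (X : Matrix m ι ℝ) (Y : Matrix m q ℝ) : Matrix ι q ℝ :=
  (Xᵀ * X)⁻¹ * Xᵀ * Y

/-- The projection matrix `X(XᵀX)⁻¹Xᵀ`. -/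
def projMat [DecidableEq ι] (X : Matrix m ι ℝ) : Matrix m m ℝ :=
  X * (Xᵀ * X)⁻¹ * Xᵀ

/-- The maximum likelihood estimator `n⁻¹ Yᵀ(I - P)Y` of the covariance matrix. -/
def mleCov [DecidableEq m] [DecidableEq ι] (X : Matrix m ι ℝ) (Y : Matrix m q ℝ) :
    Matrix q q ℝ :=
  (Fintype.card m : ℝ)⁻¹ • (Yᵀ * (1 - projMat X) * Y)

/-- `π Θ S` is a (possibly improper) density in `Θ`, for every positive definite `S`. -/
def IsPriorDensity (π : Matrix ι q ℝ → Matrix q q ℝ → ℝ) : Prop :=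
  ∀ S : Matrix q q ℝ, S.PosDef → (∀ Θ, 0 ≤ π Θ S) ∧ Measurable fun Θ => π Θ S

/-- `π` is a multivariate scale family: `π(Θ ∣ S) |S|^{k/2} = π(Θ S^{-1/2} ∣ I)` for all `Θ` and
all positive definite `S`, where `R = S^{1/2}` is the positive definite square root of `S`. -/
def IsScaleFamily [DecidableEq q] (π : Matrix ι q ℝ → Matrix q q ℝ → ℝ) : Prop :=
  ∀ S R : Matrix q q ℝ, S.PosDef → R.PosDef → R * R = S → ∀ Θ : Matrix ι q ℝ,
    π Θ S * S.det ^ ((Fintype.card ι : ℝ) / 2) = π (Θ * R⁻¹) 1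

/-- `π_M`, the supremum of `π(Θ ∣ I)` over `Θ`, as an extended nonnegative real. -/
def priorSup [DecidableEq q] (π : Matrix ι q ℝ → Matrix q q ℝ → ℝ) : ENNReal :=
  ⨆ Θ : Matrix ι q ℝ, ENNReal.ofReal (π Θ 1)

/-- The marginal likelihood `f_π(Y ∣ S) = ∫ f(Y ∣ XΘ, S) π(Θ ∣ S) dΘ` of the smooth part. -/
def smoothMarginal [DecidableEq q] (π : Matrix ι q ℝ → Matrix q q ℝ → ℝ) (X : Matrix m ι ℝ)
    (Y : Matrix m q ℝ) (S : Matrix q q ℝ) : ℝ :=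
  ∫ Θ, matNormalPDF Y (X * Θ) S * π Θ S ∂(matVolume ι q)

/-- The marginal likelihood `f_π(Y ∣ w, Θ₀, S) = (1 - w) f_π(Y ∣ S) + w f(Y ∣ XΘ₀, S)` under the
mixture prior `(1 - w) π(· ∣ S) + w δ_{Θ₀}`. -/
def mixtureMarginal [DecidableEq q] (π : Matrix ι q ℝ → Matrix q q ℝ → ℝ) (X : Matrix m ι ℝ)
    (w : ℝ) (Y : Matrix m q ℝ) (Θ₀ : Matrix ι q ℝ) (S : Matrix q q ℝ) : ℝ :=
  (1 - w) * smoothMarginal π X Y S + w * matNormalPDF Y (X * Θ₀) S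

/-- The empirical Bayes predictive density at `Z`, with the maximum likelihood estimators computed
from the data `Y` plugged in. -/
def predictive [DecidableEq m] [DecidableEq ι] [DecidableEq q]
    (π : Matrix ι q ℝ → Matrix q q ℝ → ℝ) (X : Matrix m ι ℝ) (w : ℝ)
    (Y Z : Matrix m q ℝ) : ℝ :=
  mixtureMarginal π X w Z (mleCoef X Y) (mleCov X Y)

/-- The random variable `-2 log f_π(Ỹ ∣ w, Θ̂, Ŝ) + 2 log f_π(Y ∣ w, Θ̂, Ŝ)` of the pair
`(Y, Ỹ)`, whose expectation is the bias. -/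
def lossGap [DecidableEq m] [DecidableEq ι] [DecidableEq q]
    (π : Matrix ι q ℝ → Matrix q q ℝ → ℝ) (X : Matrix m ι ℝ) (w : ℝ)
    (z : Matrix m q ℝ × Matrix m q ℝ) : ℝ :=
  -2 * Real.log (predictive π X w z.1 z.2) + 2 * Real.log (predictive π X w z.1 z.1)

/-- The joint law of two independent matrices `Y`, `Ỹ` with law `N(M, S ⊗ I)`. -/
def pairLaw [DecidableEq q] (M : Matrix m q ℝ) (S : Matrix q q ℝ) :
    Measure (Matrix m q ℝ × Matrix m q ℝ) :=
  (matNormal M S).prod (matNormal M S)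

/-- The bias `b` of `-2 log f_π(Y ∣ w, Θ̂, Ŝ)` when the true law is `N(M, S ⊗ I)`. -/
def bias [DecidableEq m] [DecidableEq ι] [DecidableEq q]
    (π : Matrix ι q ℝ → Matrix q q ℝ → ℝ) (X : Matrix m ι ℝ) (w : ℝ)
    (M : Matrix m q ℝ) (S : Matrix q q ℝ) : ℝ :=
  ∫ z, lossGap π X w z ∂(pairLaw M S)

/-- The prior is not too heavy relative to the weight: there is a sequence `ℓ → ∞` with
`sup_n (1 - w_n) ℓ_n^{p k / 2} / (w_n n^{p k / 2}) π_M < ∞`, where `p = p(n)` and `π_M` is the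
supremum of the `n`-th prior at the identity scale. -/
def WeightCondition (p : ℕ → ℕ) (w : ℕ → ℝ)
    (π : (n : ℕ) → Matrix ι (Fin (p n)) ℝ → Matrix (Fin (p n)) (Fin (p n)) ℝ → ℝ) : Prop :=
  ∃ ℓ : ℕ → ℝ, (∀ n, 0 ≤ ℓ n) ∧ Tendsto ℓ atTop atTop ∧
    (⨆ n : ℕ, ENNReal.ofReal
        ((1 - w n) * ℓ n ^ ((p n : ℝ) * (Fintype.card ι : ℝ) / 2)
          / (w n * (n : ℝ) ^ ((p n : ℝ) * (Fintype.card ι : ℝ) / 2)))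
      * priorSup (π n)) < ⊤

end MPIC

end

/-!
Fix `n`, let `q` be the number of responses and `r` the number of regressors of the candidate model,
let `X` be its design matrix, `P` the projection onto the columns of `X`, and write the data as
`Y = XΘ + E R` with `R² = Σ`, where `E` is a standard normal matrix; the independent copy is
`XΘ + F R`. A true model inside the candidate has such a mean.

**The atom.** By definition of the estimators, the predictive density at `Z` is
`w f(Z ∣ XΘ̂, Σ̂) (1 + ρ(Y, Z))`, where `ρ` (`priorRatio`) is the contribution of the smooth part of
the prior. Up to the terms `log (1 + ρ)`, the loss gap (`lossGap_regressionPair`) is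
`n tr(W⁻¹ (F - PE)ᵀ(F - PE)) - n q` with `W = Eᵀ(I - P)E` (`residGram`), which is free of `Θ` and `Σ`.
The mean of `tr(W⁻¹)` is `q / (n - q - r - 1)`: a diagonal entry `(W⁻¹)ₐₐ` is the inverse
squared distance of the column `a` of `E` to the span of the columns of `X` and the other columns of
`E`, hence an inverse chi-squared variable given the latter
(`inv_residGram_apply_self`, `lintegral_inv_residGram_apply_self`). No Wishart density is needed.
The independence of `W` and the fitted part `PE` is used as a symmetry: exchanging the fitted parts
of `E` and `F` preserves the joint law and does not change `W` (`measurePreserving_exchange`,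
`wForm_exchange`). The mean of the loss gap without the logarithms is therefore
`n q (2r + q + 1) / (n - q - r - 1)` (`integral_lossForm`).

**The smooth part.** Bounding the prior by its supremum and integrating the Gaussian likelihood over
the coefficients gives `ρ(Y, Z) ≤ a exp(Q / 2)` (`priorRatio_le`), where `Q = n tr(W⁻¹ (F - E)ᵀP(F - E))`
for an independent copy and `Q = 0` at `Z = Y`. If `a ≤ e⁻ᵇ` with `b > 0`, then
`log (1 + ρ) ≤ e^{-b/2} + (b⁻² + (2b)⁻¹) Q²`
(`log_one_add_le_of_le_mul_exp`): when `Q ≤ b` the ratio itself is at most `e^{-b/2}`, and otherwise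
the logarithm is at most `1 + Q / 2`. The second moment of `Q` is of order `q²`
(`integral_sq_gapForm`), from the second moment of an inverse chi-squared variable.

**Asymptotics.** The conditions on the weights and on the design give `a ≤ e^{-q L}` with `L → ∞` if
`r > 0` (`relative_weight_le`), so with `b = q L` the remainder is `q` times a vanishing sequence. If
`r = 0`, then `ρ(Y, Z)` does not depend on `Z` and the two logarithms cancel.
-/

noncomputable section

set_option linter.unusedSectionVars false

namespace MPIC

open ProbabilityTheory
open scoped Kronecker RealInnerProductSpace

section

/-! ### Lebesgue measure and the standard normal law on matrices -/

instance instBorelSpaceMatrix (m q : Type*) [Fintype m] [Fintype q] :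
    BorelSpace (Matrix m q ℝ) :=
  (inferInstance : BorelSpace (m → q → ℝ))

instance instSecondCountableTopologyMatrix (m q : Type*) [Fintype m] [Fintype q] :
    SecondCountableTopology (Matrix m q ℝ) :=
  (inferInstance : SecondCountableTopology (m → q → ℝ))

instance instIsAddHaarMeasureMatVolume (m q : Type*) [Fintype m] [Fintype q] :
    (matVolume m q).IsAddHaarMeasure :=
  Measure.pi.isAddHaarMeasure (fun _ : m =>
    Measure.pi fun _ : q => (volume : Measure ℝ))

instance instSigmaFiniteMatVolume (m q : Type*) [Fintype m] [Fintype q] :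
    SigmaFinite (matVolume m q) :=
  (inferInstance : SigmaFinite (volume : Measure (m → q → ℝ)))

variable {m q : Type*} [Fintype m] [Fintype q]

theorem measurable_entry (i : m) (a : q) : Measurable fun E : Matrix m q ℝ => E i a :=
  (measurable_pi_apply a).comp (measurable_pi_apply (X := fun _ : m => q → ℝ) i)

theorem measurable_matrix {α : Type*} [MeasurableSpace α] {f : α → Matrix m q ℝ}
    (hf : ∀ i a, Measurable fun x => f x i a) : Measurable f :=
  measurable_pi_lambda (X := fun _ : m => q → ℝ) _ fun i => measurable_pi_lambda _ fun a => hf i a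

theorem integral_matVolume_prod {𝕜 : Type*} [RCLike 𝕜] (f : m → q → ℝ → 𝕜) :
    ∫ E, ∏ i, ∏ a, f i a (E i a) ∂(matVolume m q) = ∏ i, ∏ a, ∫ x, f i a x := by
  have h := integral_fintype_prod_volume_eq_prod (𝕜 := 𝕜) (E := fun _ : m => q → ℝ)
    (fun i v => ∏ a, f i a (v a))
  simp only [integral_fintype_prod_volume_eq_prod] at h
  exact h

theorem integrable_matVolume_prod (f : m → q → ℝ → ℝ) (hf : ∀ i a, Integrable (f i a)) :
    Integrable (fun E => ∏ i, ∏ a, f i a (E i a)) (matVolume m q) :=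
  Integrable.fintype_prod (E := q → ℝ) (μ := fun _ : m => (volume : Measure (q → ℝ)))
    (f := fun i v => ∏ a, f i a (v a)) fun i =>
      Integrable.fintype_prod (μ := fun _ : q => (volume : Measure ℝ)) (hf i)

/-- The law of an `m × q` matrix with independent standard normal entries. -/
def stdNormal (m q : Type*) [Fintype m] [Fintype q] [DecidableEq q] : Measure (Matrix m q ℝ) :=
  matNormal 0 1

variable [DecidableEq q]

theorem trace_transpose_mul_self (E : Matrix m q ℝ) : (Eᵀ * E).trace = ∑ i, ∑ a, E i a ^ 2 := by
  rw [Finset.sum_comm]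
  simp [Matrix.trace, Matrix.mul_apply, pow_two]

theorem matNormalPDF_nonneg (Y M : Matrix m q ℝ) {S : Matrix q q ℝ} (hS : S.PosDef) :
    0 ≤ matNormalPDF Y M S := by
  have := hS.det_pos
  unfold matNormalPDF
  positivity

theorem matNormalPDF_zero_one (E : Matrix m q ℝ) :
    matNormalPDF E 0 1 = ∏ i, ∏ a, gaussianPDFReal 0 1 (E i a) := by
  have h2 : (0 : ℝ) ≤ 2 * Real.pi := by positivity
  simp only [matNormalPDF, gaussianPDFReal_def, Finset.prod_mul_distrib, Finset.prod_const,
    ← Real.exp_sum, trace_transpose_mul_self, sub_zero, inv_one, one_mul, Matrix.det_one,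
    Real.one_rpow, mul_one, NNReal.coe_one]
  congr 1
  · rw [← Real.rpow_neg_one, Real.sqrt_eq_rpow, ← Real.rpow_mul h2, ← pow_mul,
      ← Real.rpow_natCast, ← Real.rpow_mul h2]
    congr 1
    simp only [Finset.card_univ, Nat.cast_mul]
    ring
  · rw [Finset.mul_sum]
    congr 1
    refine Finset.sum_congr rfl fun i _ => ?_
    rw [Finset.mul_sum]
    refine Finset.sum_congr rfl fun a _ => ?_
    ring

theorem measurable_matNormalPDF (M : Matrix m q ℝ) (S : Matrix q q ℝ) :
    Measurable fun Y => matNormalPDF Y M S := by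
  unfold matNormalPDF
  simp only [Matrix.trace, Matrix.diag, Matrix.mul_apply, Matrix.transpose_apply, Matrix.sub_apply]
  have := measurable_entry (m := m) (q := q)
  fun_prop

theorem integral_stdNormal_prod {𝕜 : Type*} [RCLike 𝕜] (f : m → q → ℝ → 𝕜) :
    ∫ E, ∏ i, ∏ a, f i a (E i a) ∂(stdNormal m q) =
      ∏ i, ∏ a, ∫ x, f i a x ∂(gaussianReal 0 1) := by
  rw [stdNormal, matNormal, integral_withDensity_eq_integral_toReal_smul
    (measurable_matNormalPDF 0 1).ennreal_ofReal (ae_of_all _ fun _ => ENNReal.ofReal_lt_top)]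
  have h : ∀ E : Matrix m q ℝ, (ENNReal.ofReal (matNormalPDF E 0 1)).toReal •
      ∏ i, ∏ a, f i a (E i a) = ∏ i, ∏ a, gaussianPDFReal 0 1 (E i a) • f i a (E i a) := by
    intro E
    rw [ENNReal.toReal_ofReal (matNormalPDF_nonneg _ _ Matrix.PosDef.one), matNormalPDF_zero_one]
    simp only [RCLike.real_smul_eq_coe_mul, Finset.prod_mul_distrib, RCLike.ofReal_prod]
  simp only [h]
  rw [integral_matVolume_prod (fun i a x => gaussianPDFReal 0 1 x • f i a x)]
  simp only [integral_gaussianReal_eq_integral_smul one_ne_zero]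

instance : IsProbabilityMeasure (stdNormal m q) := by
  refine ⟨?_⟩
  have hint : Integrable (fun E : Matrix m q ℝ => matNormalPDF E 0 1) (matVolume m q) := by
    simp only [matNormalPDF_zero_one]
    exact integrable_matVolume_prod (fun _ _ => gaussianPDFReal 0 1)
      fun _ _ => integrable_gaussianPDFReal 0 1
  rw [stdNormal, matNormal, withDensity_apply _ MeasurableSet.univ, Measure.restrict_univ,
    ← ofReal_integral_eq_lintegral_ofReal hint
      (ae_of_all _ fun _ => matNormalPDF_nonneg _ _ Matrix.PosDef.one)]
  simp only [matNormalPDF_zero_one]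
  rw [integral_matVolume_prod (fun _ _ => gaussianPDFReal 0 1)]
  simp [integral_gaussianPDFReal_eq_one]

/-- A linear image of a standard normal matrix is centred Gaussian, with covariance form
`t ↦ ∑ ⟨L e_{ia}, t⟩²`. -/
theorem charFun_map_stdNormal [DecidableEq m] {F : Type*} [NormedAddCommGroup F]
    [InnerProductSpace ℝ F]
    [MeasurableSpace F] [BorelSpace F] [SecondCountableTopology F]
    (L : Matrix m q ℝ →ₗ[ℝ] F) (t : F) :
    charFun ((stdNormal m q).map L) t =
      Complex.exp (-((∑ i, ∑ a, ⟪L (Matrix.single i a 1), t⟫ ^ 2 : ℝ) : ℂ) / 2) := by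
  have hL : Measurable L := L.continuous_of_finiteDimensional.measurable
  rw [charFun_apply, integral_map hL.aemeasurable
    (Measurable.aestronglyMeasurable (by fun_prop))]
  have h : ∀ E : Matrix m q ℝ, Complex.exp ((⟪L E, t⟫ : ℝ) * Complex.I) =
      ∏ i, ∏ a, Complex.exp ((⟪L (Matrix.single i a 1), t⟫ : ℝ) * (E i a : ℂ) * Complex.I) := by
    intro E
    simp only [← Complex.exp_sum]
    congr 1
    conv_lhs => rw [Matrix.matrix_eq_sum_single E]
    simp only [map_sum, sum_inner, Complex.ofReal_sum, Finset.sum_mul]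
    refine Finset.sum_congr rfl fun i _ => Finset.sum_congr rfl fun a _ => ?_
    have : Matrix.single i a (E i a) = E i a • Matrix.single i a (1 : ℝ) := by simp
    rw [this, map_smul, real_inner_smul_left]
    push_cast
    ring
  simp only [h]
  rw [integral_stdNormal_prod (fun i a (x : ℝ) =>
    Complex.exp ((⟪L (Matrix.single i a 1), t⟫ : ℝ) * (x : ℂ) * Complex.I))]
  simp only [← charFun_apply_real, charFun_gaussianReal, ← Complex.exp_sum]
  congr 1
  push_cast
  rw [neg_div, Finset.sum_div, ← Finset.sum_neg_distrib]
  refine Finset.sum_congr rfl fun i _ => ?_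
  rw [Finset.sum_div, ← Finset.sum_neg_distrib]
  refine Finset.sum_congr rfl fun i _ => ?_
  simp

/-- The linear map `E ↦ B E C` on matrices. -/
def mulLeftRight (B : Matrix m m ℝ) (C : Matrix q q ℝ) : Matrix m q ℝ →ₗ[ℝ] Matrix m q ℝ where
  toFun E := B * E * C
  map_add' := by intros; simp [Matrix.mul_add, Matrix.add_mul]
  map_smul' := by intros; simp

theorem det_mulLeftRight [DecidableEq m] (B : Matrix m m ℝ) (C : Matrix q q ℝ) :
    LinearMap.det (mulLeftRight B C) = B.det ^ Fintype.card q * C.det ^ Fintype.card m := by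
  let e : Matrix m q ℝ ≃ₗ[ℝ] (q × m → ℝ) :=
    { toFun := Matrix.vec
      map_add' := Matrix.vec_add
      map_smul' := Matrix.vec_smul
      invFun := fun v => Matrix.of fun i a => v (a, i)
      left_inv := fun _ => rfl
      right_inv := fun _ => rfl }
  have h : e.toLinearMap ∘ₗ mulLeftRight B C ∘ₗ e.symm.toLinearMap =
      Matrix.toLin' (Cᵀ ⊗ₖ B) := by
    refine LinearMap.ext fun v => ?_
    have : v = (e.symm v).vec := (e.apply_symm_apply v).symm
    simp only [LinearMap.comp_apply, LinearEquiv.coe_coe, Matrix.toLin'_apply]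
    conv_rhs => rw [this, Matrix.kronecker_mulVec_vec, Matrix.transpose_transpose]
    rfl
  rw [← LinearMap.det_conj _ e, h, LinearMap.det_toLin', Matrix.det_kronecker,
    Matrix.det_transpose, mul_comm]

end

section

variable {m q : Type*} [Fintype m] [Fintype q] [DecidableEq q]

/-! ### Symmetries and affine images of the standard normal law -/

theorem map_matVolume_linear (f : Matrix m q ℝ →ₗ[ℝ] Matrix m q ℝ) (hf : LinearMap.det f ≠ 0) :
    (matVolume m q).map f = ENNReal.ofReal |(LinearMap.det f)⁻¹| • matVolume m q :=
  Measure.map_linearMap_addHaar_eq_smul_addHaar (E := m → q → ℝ) volume hf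

/-- A linear involution has determinant `±1`. -/
theorem measurePreserving_of_involution {E : Type*} [NormedAddCommGroup E] [NormedSpace ℝ E]
    [MeasurableSpace E] [BorelSpace E] [FiniteDimensional ℝ E] (μ : Measure E)
    [μ.IsAddHaarMeasure] (f : E →ₗ[ℝ] E) (hf : ∀ x, f (f x) = x) : MeasurePreserving f μ μ := by
  have h : LinearMap.det f * LinearMap.det f = 1 := by
    rw [← LinearMap.det_comp, show f ∘ₗ f = LinearMap.id from LinearMap.ext hf, LinearMap.det_id]
  have h0 : LinearMap.det f ≠ 0 := fun h0 => by simp [h0] at h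
  refine ⟨f.continuous_of_finiteDimensional.measurable, ?_⟩
  have h1 : |(LinearMap.det f)⁻¹| = 1 := by
    rcases mul_self_eq_one_iff.mp h with h | h <;> simp [h]
  rw [Measure.map_linearMap_addHaar_eq_smul_addHaar μ h0, h1, ENNReal.ofReal_one, one_smul]

theorem measurePreserving_involution_matVolume
    (f : Matrix m q ℝ × Matrix m q ℝ →ₗ[ℝ] Matrix m q ℝ × Matrix m q ℝ)
    (hf : ∀ x, f (f x) = x) :
    MeasurePreserving f ((matVolume m q).prod (matVolume m q))
      ((matVolume m q).prod (matVolume m q)) :=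
  haveI : (volume : Measure (m → q → ℝ)).IsAddHaarMeasure := instIsAddHaarMeasureMatVolume m q
  haveI : ((volume : Measure (m → q → ℝ)).prod (volume : Measure (m → q → ℝ))).IsAddHaarMeasure :=
    Measure.prod.instIsAddHaarMeasure _ _
  measurePreserving_of_involution (E := (m → q → ℝ) × (m → q → ℝ))
    ((volume : Measure (m → q → ℝ)).prod volume) f hf

theorem measurePreserving_withDensity {α : Type*} [MeasurableSpace α] {μ : Measure α}
    {f : α → α} (hf : MeasurePreserving f μ μ) {g : α → ENNReal} (hg : Measurable g)
    (hgf : ∀ x, g (f x) = g x) :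
    MeasurePreserving f (μ.withDensity g) (μ.withDensity g) := by
  refine ⟨hf.measurable, Measure.ext fun s hs => ?_⟩
  rw [Measure.map_apply hf.measurable hs, withDensity_apply _ hs,
    withDensity_apply _ (hf.measurable hs)]
  conv_rhs => rw [← hf.map_eq, setLIntegral_map hs hg hf.measurable]
  simp only [hgf]

/-- The exchange of the components `A E B` and `A F B` of two matrices `E` and `F`. -/
def exchange (A : Matrix m m ℝ) (B : Matrix q q ℝ) :
    Matrix m q ℝ × Matrix m q ℝ →ₗ[ℝ] Matrix m q ℝ × Matrix m q ℝ where
  toFun z := (z.1 + A * (z.2 - z.1) * B, z.2 - A * (z.2 - z.1) * B)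
  map_add' z w := by
    ext <;> simp [Matrix.mul_add, Matrix.add_mul, Matrix.mul_sub, Matrix.sub_mul] <;> ring
  map_smul' c z := by
    ext <;> simp [Matrix.mul_sub, Matrix.sub_mul] <;> ring

/-- Exchanging components of two independent standard normal matrices under an orthogonal
projection `E ↦ A E B` does not change their joint law. -/
theorem measurePreserving_exchange {A : Matrix m m ℝ} {B : Matrix q q ℝ}
    (hA : A * A = A) (hA' : Aᵀ = A) (hB : B * B = B) (hB' : Bᵀ = B) :
    MeasurePreserving (exchange A B) ((stdNormal m q).prod (stdNormal m q))
      ((stdNormal m q).prod (stdNormal m q)) := by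
  have hproj : ∀ H : Matrix m q ℝ, A * (A * H * B) * B = A * H * B := fun H => by
    rw [Matrix.mul_assoc A H B, ← Matrix.mul_assoc A A, hA, Matrix.mul_assoc A, Matrix.mul_assoc H,
      hB]
  have hmeas := (measurable_matNormalPDF (0 : Matrix m q ℝ) 1).ennreal_ofReal
  rw [stdNormal, matNormal, prod_withDensity hmeas hmeas]
  refine measurePreserving_withDensity (measurePreserving_involution_matVolume _ fun z => ?_)
    ((hmeas.comp measurable_fst).mul (hmeas.comp measurable_snd)) fun z => ?_
  · have h : (z.2 - A * (z.2 - z.1) * B - (z.1 + A * (z.2 - z.1) * B)) =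
      (z.2 - z.1) - (A * (z.2 - z.1) * B + A * (z.2 - z.1) * B) := by abel
    have h2 : A * (z.2 - A * (z.2 - z.1) * B - (z.1 + A * (z.2 - z.1) * B)) * B =
        - (A * (z.2 - z.1) * B) := by
      rw [h, Matrix.mul_sub, Matrix.sub_mul, Matrix.mul_add, Matrix.add_mul, hproj]
      abel
    ext1
    · change z.1 + A * (z.2 - z.1) * B +
        A * (z.2 - A * (z.2 - z.1) * B - (z.1 + A * (z.2 - z.1) * B)) * B = z.1
      rw [h2]; abel
    · change z.2 - A * (z.2 - z.1) * B -
        A * (z.2 - A * (z.2 - z.1) * B - (z.1 + A * (z.2 - z.1) * B)) * B = z.2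
      rw [h2]; abel
  · obtain ⟨E, F⟩ := z
    have hpos := fun E : Matrix m q ℝ => matNormalPDF_nonneg E 0 (Matrix.PosDef.one (n := q))
    change ENNReal.ofReal (matNormalPDF (E + A * (F - E) * B) 0 1) *
      ENNReal.ofReal (matNormalPDF (F - A * (F - E) * B) 0 1) =
      ENNReal.ofReal (matNormalPDF E 0 1) * ENNReal.ofReal (matNormalPDF F 0 1)
    rw [← ENNReal.ofReal_mul (hpos _), ← ENNReal.ofReal_mul (hpos _)]
    congr 1
    simp only [matNormalPDF, sub_zero, inv_one, Matrix.one_mul]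
    rw [mul_mul_mul_comm, mul_mul_mul_comm _ (Real.exp _), ← Real.exp_add, ← Real.exp_add]
    congr 2
    set D := A * (F - E) * B with hD
    -- `D` is the orthogonal projection of `F - E`, so the sum of the squared norms is unchanged
    have h1 : (Dᵀ * D).trace = (Dᵀ * (F - E)).trace := by
      have : Dᵀ = Bᵀ * (F - E)ᵀ * Aᵀ := by
        rw [hD, Matrix.transpose_mul, Matrix.transpose_mul, Matrix.mul_assoc]
      have hD2 : Dᵀ * D = B * ((F - E)ᵀ * A * (F - E) * B) := by
        rw [this, hD, hA', hB']
        simp only [Matrix.mul_assoc]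
        rw [← Matrix.mul_assoc A A, hA]
      rw [hD2, Matrix.trace_mul_comm, Matrix.mul_assoc _ B B, hB, Matrix.trace_mul_comm, this,
        hA', hB']
      simp only [Matrix.mul_assoc]
    have h2 : (Eᵀ * D).trace = (Dᵀ * E).trace := by
      rw [← Matrix.trace_transpose, Matrix.transpose_mul, Matrix.transpose_transpose]
    have h3 : (Fᵀ * D).trace = (Dᵀ * F).trace := by
      rw [← Matrix.trace_transpose, Matrix.transpose_mul, Matrix.transpose_transpose]
    simp only [Matrix.transpose_add, Matrix.transpose_sub, Matrix.mul_add, Matrix.mul_sub,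
      Matrix.add_mul, Matrix.sub_mul, Matrix.trace_add, Matrix.trace_sub, h2, h3] at h1 ⊢
    linarith

/-- The change of variables `E ↦ M + B E C` in Lebesgue measure. -/
theorem lintegral_matVolume_affine [DecidableEq m] (M : Matrix m q ℝ) {B : Matrix m m ℝ}
    {C : Matrix q q ℝ} (hB : B.det ≠ 0) (hC : C.det ≠ 0) (g : Matrix m q ℝ → ENNReal)
    (hg : Measurable g) :
    ∫⁻ Y, g Y ∂(matVolume m q) = ENNReal.ofReal
      (|B.det| ^ Fintype.card q * |C.det| ^ Fintype.card m) *
        ∫⁻ E, g (M + B * E * C) ∂(matVolume m q) := by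
  have hdet : LinearMap.det (mulLeftRight B C) ≠ 0 := by
    rw [det_mulLeftRight]; positivity
  have hφ : Measurable (mulLeftRight B C) :=
    (mulLeftRight B C).continuous_of_finiteDimensional.measurable
  have h1 : ∫⁻ Y, g Y ∂(matVolume m q) = ∫⁻ Y, g (M + Y) ∂(matVolume m q) :=
    haveI : (volume : Measure (m → q → ℝ)).IsAddHaarMeasure := instIsAddHaarMeasureMatVolume m q
    (lintegral_add_left_eq_self (G := m → q → ℝ) (μ := volume) g M).symm
  have hM : Measurable fun Y : Matrix m q ℝ => g (M + Y) :=
    hg.comp (Continuous.measurable (by fun_prop))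
  have h2 : ∫⁻ E, g (M + B * E * C) ∂(matVolume m q) =
      ∫⁻ Y, g (M + Y) ∂((matVolume m q).map (mulLeftRight B C)) :=
    (lintegral_map hM hφ).symm
  rw [h2, map_matVolume_linear _ hdet, lintegral_smul_measure, h1,
    smul_eq_mul, ← mul_assoc, ← ENNReal.ofReal_mul (by positivity), det_mulLeftRight]
  have : |B.det| ^ Fintype.card q * |C.det| ^ Fintype.card m *
      |(B.det ^ Fintype.card q * C.det ^ Fintype.card m)⁻¹| = 1 := by
    rw [abs_inv, abs_mul, abs_pow, abs_pow, mul_inv_cancel₀ (by positivity)]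
  rw [this, ENNReal.ofReal_one, one_mul]

theorem det_rpow_half {R S : Matrix q q ℝ} (hR : R.PosDef) (hRS : R * R = S) (k : ℕ) :
    S.det ^ ((k : ℝ) / 2) = R.det ^ k := by
  rw [← hRS, Matrix.det_mul, ← pow_two, ← Real.rpow_natCast, ← Real.rpow_mul hR.det_pos.le,
    ← Real.rpow_natCast]
  congr 1
  push_cast
  ring

/-- `N(M, S ⊗ I)` is the law of `M + E S^{1/2}` for a standard normal matrix `E`. -/
theorem map_stdNormal_affine [DecidableEq m] (M : Matrix m q ℝ) {R S : Matrix q q ℝ}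
    (hR : R.PosDef) (hRS : R * R = S) :
    (stdNormal m q).map (fun E => M + E * R) = matNormal M S := by
  have hRdet := hR.det_pos
  have hRt : Rᵀ = R := by simpa using hR.isHermitian.eq
  have hφ : Measurable fun E : Matrix m q ℝ => M + E * R :=
    Continuous.measurable (by fun_prop)
  have hSinv : S⁻¹ = R⁻¹ * R⁻¹ := by rw [← hRS, Matrix.mul_inv_rev]
  have hpdf : ∀ E : Matrix m q ℝ, matNormalPDF E 0 1 =
      |R.det| ^ Fintype.card m * matNormalPDF (M + E * R) M S := by
    intro E
    have h1 : (S⁻¹ * ((E * R)ᵀ * (E * R))).trace = (Eᵀ * E).trace := by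
      have hu : IsUnit R.det := hRdet.ne'.isUnit
      rw [hSinv, Matrix.transpose_mul, hRt, Matrix.mul_assoc, ← Matrix.mul_assoc R⁻¹ (R * Eᵀ),
        ← Matrix.mul_assoc R⁻¹ R, Matrix.nonsing_inv_mul _ hu, Matrix.one_mul,
        Matrix.trace_mul_comm, Matrix.mul_assoc, Matrix.mul_assoc, Matrix.mul_nonsing_inv _ hu,
        Matrix.mul_one]
    simp only [matNormalPDF, sub_zero, inv_one, Matrix.one_mul, add_sub_cancel_left, h1,
      Matrix.det_one, Real.one_rpow, mul_one]
    have h2 : S.det ^ (-((Fintype.card m : ℝ) / 2)) = (R.det ^ Fintype.card m)⁻¹ := by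
      rw [Real.rpow_neg (by rw [← hRS, Matrix.det_mul]; positivity), det_rpow_half hR hRS]
    rw [h2, abs_of_pos hRdet]
    field_simp
  refine Measure.ext fun s hs => ?_
  rw [Measure.map_apply hφ hs, stdNormal, matNormal, matNormal, withDensity_apply _ hs,
    withDensity_apply _ (hφ hs), ← lintegral_indicator hs, ← lintegral_indicator (hφ hs),
    lintegral_matVolume_affine M (B := 1) (C := R) (by simp) hRdet.ne' _
      ((measurable_matNormalPDF M S).ennreal_ofReal.indicator hs),
    ← lintegral_const_mul]
  · refine lintegral_congr fun E => ?_
    simp only [Matrix.one_mul, Matrix.det_one, abs_one, one_pow, one_mul]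
    by_cases hE : M + E * R ∈ s
    · rw [Set.indicator_of_mem (show E ∈ (fun E => M + E * R) ⁻¹' s from hE),
        Set.indicator_of_mem hE, hpdf, ENNReal.ofReal_mul (by positivity)]
    · rw [Set.indicator_of_notMem (show E ∉ (fun E => M + E * R) ⁻¹' s from hE),
        Set.indicator_of_notMem hE, mul_zero]
  · refine ((measurable_matNormalPDF M S).ennreal_ofReal.indicator hs).comp
      (Continuous.measurable (by fun_prop))

end

section

/-! ### Inverse moments of the chi-squared distribution -/

theorem integral_one_add_two_mul_rpow {c : ℝ} (hc : 1 < c) :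
    IntegrableOn (fun t : ℝ => (1 + 2 * t) ^ (-c)) (Set.Ioi 0) ∧
      ∫ t in Set.Ioi (0 : ℝ), (1 + 2 * t) ^ (-c) = 1 / (2 * (c - 1)) := by
  have hderiv : ∀ t ∈ Set.Ici (0 : ℝ),
      HasDerivAt (fun t : ℝ => -(1 + 2 * t) ^ (1 - c) / (2 * (c - 1))) ((1 + 2 * t) ^ (-c)) t := by
    intro t ht
    have ht' : (0 : ℝ) ≤ t := ht
    have h1 : HasDerivAt (fun t : ℝ => 1 + 2 * t) 2 t := by
      simpa using ((hasDerivAt_id t).const_mul 2).const_add 1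
    have h2 := ((h1.rpow_const (p := 1 - c) (Or.inl (by positivity))).neg).div_const (2 * (c - 1))
    have hc' : c - 1 ≠ 0 := by linarith
    have h3 : (1 + 2 * t) ^ (-c) =
        -(2 * (1 - c) * (1 + 2 * t) ^ (1 - c - 1)) / (2 * (c - 1)) := by
      rw [show 1 - c - 1 = -c by ring]
      field_simp
      ring
    rw [h3]
    exact h2
  have hpos : ∀ t ∈ Set.Ioi (0 : ℝ), 0 ≤ (1 + 2 * t) ^ (-c) := fun t ht => by
    have ht' : (0 : ℝ) < t := ht
    positivity
  have hlim : Tendsto (fun t : ℝ => -(1 + 2 * t) ^ (1 - c) / (2 * (c - 1))) atTop (𝓝 0) := by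
    have h1 : Tendsto (fun t : ℝ => 1 + 2 * t) atTop atTop :=
      tendsto_atTop_add_const_left _ _ (tendsto_id.const_mul_atTop two_pos)
    have h2 := (tendsto_rpow_neg_atTop (y := c - 1) (by linarith)).comp h1
    have h3 := (h2.neg).div_const (2 * (c - 1))
    simpa [Function.comp_def, neg_sub] using h3
  refine ⟨integrableOn_Ioi_deriv_of_nonneg' hderiv hpos hlim, ?_⟩
  rw [integral_Ioi_of_hasDerivAt_of_nonneg' hderiv hpos hlim]
  simp [neg_div]

theorem integral_mul_one_add_two_mul_rpow {c : ℝ} (hc : 2 < c) :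
    IntegrableOn (fun t : ℝ => t * (1 + 2 * t) ^ (-c)) (Set.Ioi 0) ∧
      ∫ t in Set.Ioi (0 : ℝ), t * (1 + 2 * t) ^ (-c) = 1 / (4 * (c - 1) * (c - 2)) := by
  obtain ⟨h1, h1'⟩ := integral_one_add_two_mul_rpow (c := c) (by linarith)
  obtain ⟨h2, h2'⟩ := integral_one_add_two_mul_rpow (c := c - 1) (by linarith)
  have h : Set.EqOn (fun t : ℝ => t * (1 + 2 * t) ^ (-c))
      (fun t => (1 / 2) * ((1 + 2 * t) ^ (-(c - 1)) - (1 + 2 * t) ^ (-c))) (Set.Ioi 0) := by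
    intro t ht
    have ht' : (0 : ℝ) < t := ht
    have h3 : (1 + 2 * t) ^ (-(c - 1)) = (1 + 2 * t) * (1 + 2 * t) ^ (-c) := by
      rw [show -(c - 1) = 1 + -c by ring, Real.rpow_add (by positivity), Real.rpow_one]
    simp only [h3]
    ring
  refine ⟨(integrableOn_congr_fun h measurableSet_Ioi).mpr ((h2.sub h1).const_mul (1 / 2)), ?_⟩
  rw [setIntegral_congr_fun measurableSet_Ioi h, integral_const_mul, integral_sub h2 h1, h1', h2']
  have : c - 1 ≠ 0 := by linarith
  have : c - 2 ≠ 0 := by linarith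
  rw [show c - 1 - 1 = c - 2 by ring]
  field_simp
  ring

theorem lintegral_rpow_mul_exp_neg_mul {a s : ℝ} (ha : 0 < a) (hs : 0 < s) :
    ∫⁻ t in Set.Ioi (0 : ℝ), ENNReal.ofReal (t ^ (a - 1) * Real.exp (-(s * t))) =
      ENNReal.ofReal ((1 / s) ^ a * Real.Gamma a) := by
  have h := Real.integral_rpow_mul_exp_neg_mul_Ioi ha hs
  rw [← h, ofReal_integral_eq_lintegral_ofReal]
  · by_contra hi
    have h0 := integral_undef hi
    rw [h] at h0
    have := Real.Gamma_pos_of_pos ha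
    have : 0 < (1 / s) ^ a * Real.Gamma a := by positivity
    linarith
  · filter_upwards [ae_restrict_mem measurableSet_Ioi] with t ht
    have ht' : (0 : ℝ) < t := ht
    positivity

theorem integral_exp_neg_mul_sq_gaussianReal {t : ℝ} (ht : 0 ≤ t) :
    ∫ x, Real.exp (-(t * x ^ 2)) ∂(gaussianReal 0 1) = (1 + 2 * t) ^ (-(1 / 2) : ℝ) := by
  rw [integral_gaussianReal_eq_integral_smul one_ne_zero]
  have h : ∀ x : ℝ, gaussianPDFReal 0 1 x • Real.exp (-(t * x ^ 2)) =
      (√(2 * Real.pi))⁻¹ * Real.exp (-(t + 1 / 2) * x ^ 2) := by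
    intro x
    rw [gaussianPDFReal_def, smul_eq_mul, mul_assoc, ← Real.exp_add]
    simp only [NNReal.coe_one, mul_one]
    congr 2
    ring
  simp only [h]
  rw [integral_const_mul, integral_gaussian, ← Real.sqrt_inv, ← Real.sqrt_mul (by positivity),
    Real.rpow_neg (by positivity), ← Real.sqrt_eq_rpow, ← Real.sqrt_inv]
  congr 1
  have := Real.pi_pos
  field_simp
  ring

variable {U : Type*} [NormedAddCommGroup U] [InnerProductSpace ℝ U] [FiniteDimensional ℝ U]
  [MeasurableSpace U] [BorelSpace U]

theorem lintegral_exp_neg_mul_norm_sq_stdGaussian {t : ℝ} (ht : 0 ≤ t) :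
    ∫⁻ x, ENNReal.ofReal (Real.exp (-(‖x‖ ^ 2 * t))) ∂(stdGaussian U) =
      ENNReal.ofReal ((1 + 2 * t) ^ (-((Module.finrank ℝ U : ℝ) / 2))) := by
  have hint : Integrable (fun x : U => Real.exp (-(‖x‖ ^ 2 * t))) (stdGaussian U) := by
    refine Integrable.of_bound (C := 1) (Measurable.aestronglyMeasurable (by fun_prop))
      (ae_of_all _ fun x => ?_)
    rw [Real.norm_eq_abs, Real.abs_exp, Real.exp_le_one_iff]
    have : 0 ≤ ‖x‖ ^ 2 * t := by positivity
    linarith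
  rw [← ofReal_integral_eq_lintegral_ofReal hint (ae_of_all _ fun _ => (Real.exp_pos _).le)]
  congr 1
  rw [stdGaussian, integral_map (Measurable.aemeasurable (by fun_prop))
    (Measurable.aestronglyMeasurable (by fun_prop))]
  have h : ∀ x : Fin (Module.finrank ℝ U) → ℝ,
      Real.exp (-(‖∑ i, x i • stdOrthonormalBasis ℝ U i‖ ^ 2 * t)) =
        ∏ i, Real.exp (-(t * x i ^ 2)) := by
    intro x
    rw [← Real.exp_sum, ← real_inner_self_eq_norm_sq,
      (stdOrthonormalBasis ℝ U).orthonormal.inner_sum, Finset.sum_mul, ← Finset.sum_neg_distrib]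
    congr 1
    refine Finset.sum_congr rfl fun i _ => ?_
    simp
    ring
  simp only [h]
  rw [integral_fintype_prod_eq_pow (fun x : ℝ => Real.exp (-(t * x ^ 2))),
    integral_exp_neg_mul_sq_gaussianReal ht, Fintype.card_fin,
    ← Real.rpow_natCast, ← Real.rpow_mul (by positivity)]
  congr 1
  ring

theorem stdGaussian_singleton_zero (hd : 0 < Module.finrank ℝ U) : stdGaussian U {0} = 0 := by
  have : Nonempty (Fin (Module.finrank ℝ U)) := ⟨⟨0, hd⟩⟩
  rw [stdGaussian, Measure.map_apply (by fun_prop) (measurableSet_singleton _)]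
  have h : (fun x : Fin (Module.finrank ℝ U) → ℝ => ∑ i, x i • stdOrthonormalBasis ℝ U i) ⁻¹' {0}
      = {0} := by
    ext x
    simp only [Set.mem_preimage, Set.mem_singleton_iff]
    refine ⟨fun hx => funext fun i => ?_, fun hx => by simp [hx]⟩
    exact Fintype.linearIndependent_iff.mp
      (stdOrthonormalBasis ℝ U).orthonormal.linearIndependent x hx i
  have : NullSingletonClass (gaussianReal 0 1) := nullSingletonClass_gaussianReal one_ne_zero
  rw [h]
  exact measure_singleton _

/-- The Gamma integral writes an inverse power of `‖x‖²` as a mixture of the functions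
`exp (-t ‖x‖²)`, whose Gaussian means are explicit. -/
theorem lintegral_inv_norm_sq_rpow_stdGaussian (hd : 0 < Module.finrank ℝ U) {a : ℝ}
    (ha : 0 < a) :
    ∫⁻ x, ENNReal.ofReal ((1 / ‖x‖ ^ 2) ^ a * Real.Gamma a) ∂(stdGaussian U) =
      ∫⁻ t in Set.Ioi (0 : ℝ),
        ENNReal.ofReal (t ^ (a - 1) * (1 + 2 * t) ^ (-((Module.finrank ℝ U : ℝ) / 2))) := by
  have h0 : ∀ᵐ x ∂(stdGaussian U), x ≠ 0 := by
    simpa [ae_iff] using stdGaussian_singleton_zero hd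
  calc _ = ∫⁻ x, ∫⁻ t in Set.Ioi (0 : ℝ),
        ENNReal.ofReal (t ^ (a - 1) * Real.exp (-(‖x‖ ^ 2 * t))) ∂volume ∂(stdGaussian U) := by
        refine lintegral_congr_ae (h0.mono fun x hx => ?_)
        exact (lintegral_rpow_mul_exp_neg_mul ha (by positivity)).symm
    _ = ∫⁻ t in Set.Ioi (0 : ℝ), ∫⁻ x,
        ENNReal.ofReal (t ^ (a - 1) * Real.exp (-(‖x‖ ^ 2 * t))) ∂(stdGaussian U) := by
        refine lintegral_lintegral_swap (Measurable.aemeasurable ?_)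
        simp only [Function.uncurry_def]
        fun_prop
    _ = _ := by
        refine setLIntegral_congr_fun measurableSet_Ioi fun t ht => ?_
        have ht' : (0 : ℝ) < t := ht
        have hp : 0 ≤ t ^ (a - 1) := by positivity
        simp only [ENNReal.ofReal_mul hp]
        rw [lintegral_const_mul _ (by fun_prop), lintegral_exp_neg_mul_norm_sq_stdGaussian ht'.le]

/-- The first inverse moment of a chi-squared variable with `d` degrees of freedom. -/
theorem lintegral_inv_norm_sq_stdGaussian (hd : 2 < Module.finrank ℝ U) :
    ∫⁻ x, ENNReal.ofReal ((‖x‖ ^ 2)⁻¹) ∂(stdGaussian U) =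
      ENNReal.ofReal (1 / ((Module.finrank ℝ U : ℝ) - 2)) := by
  have hd' : (2 : ℝ) < Module.finrank ℝ U := by exact_mod_cast hd
  have h := lintegral_inv_norm_sq_rpow_stdGaussian (U := U) (by omega) one_pos
  simp only [Real.rpow_one, Real.Gamma_one, mul_one, sub_self, Real.rpow_zero, one_mul,
    one_div] at h
  obtain ⟨h1, h2⟩ := integral_one_add_two_mul_rpow (c := (Module.finrank ℝ U : ℝ) / 2)
    (by linarith)
  rw [h, ← ofReal_integral_eq_lintegral_ofReal h1, h2]
  · congr 2; ring
  · filter_upwards [ae_restrict_mem measurableSet_Ioi] with t ht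
    have ht' : (0 : ℝ) < t := ht
    positivity

/-- The second inverse moment of a chi-squared variable with `d` degrees of freedom. -/
theorem lintegral_inv_norm_sq_sq_stdGaussian (hd : 4 < Module.finrank ℝ U) :
    ∫⁻ x, ENNReal.ofReal (((‖x‖ ^ 2)⁻¹) ^ 2) ∂(stdGaussian U) =
      ENNReal.ofReal
        (1 / (((Module.finrank ℝ U : ℝ) - 2) * ((Module.finrank ℝ U : ℝ) - 4))) := by
  have hd' : (4 : ℝ) < Module.finrank ℝ U := by exact_mod_cast hd
  have h := lintegral_inv_norm_sq_rpow_stdGaussian (U := U) (by omega) two_pos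
  simp only [Real.rpow_two, Real.Gamma_two, mul_one, show (2 : ℝ) - 1 = 1 by norm_num,
    Real.rpow_one, one_div] at h
  obtain ⟨h1, h2⟩ := integral_mul_one_add_two_mul_rpow (c := (Module.finrank ℝ U : ℝ) / 2)
    (by linarith)
  rw [h, ← ofReal_integral_eq_lintegral_ofReal h1, h2]
  · congr 2; ring
  · filter_upwards [ae_restrict_mem measurableSet_Ioi] with t ht
    have ht' : (0 : ℝ) < t := ht
    positivity

end

section

variable {m ι q : Type*} [Fintype m] [Fintype ι] [Fintype q] [DecidableEq q]

/-! ### Columns of a standard normal matrix -/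

/-- The `a`-th column of a matrix, as a Euclidean vector. -/
def euclCol {κ : Type*} (E : Matrix m κ ℝ) (a : κ) : EuclideanSpace ℝ m :=
  WithLp.toLp 2 fun i => E i a

theorem inner_euclCol {κ κ' : Type*} (E : Matrix m κ ℝ) (F : Matrix m κ' ℝ) (a : κ) (b : κ') :
    ⟪euclCol E a, euclCol F b⟫ = (Eᵀ * F) a b := by
  rw [euclCol, euclCol, EuclideanSpace.inner_toLp_toLp]
  simp [dotProduct, Matrix.mul_apply, mul_comm]

/-- The orthogonal projection of the `a`-th column onto `K`. -/
def colProj (K : Submodule ℝ (EuclideanSpace ℝ m)) (a : q) : Matrix m q ℝ →ₗ[ℝ] K where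
  toFun E := K.orthogonalProjectionOnto (euclCol E a)
  map_add' E F := by rw [← map_add]; rfl
  map_smul' c E := by rw [RingHom.id_apply, ← map_smul]; rfl

/-- The projection of a column of a standard normal matrix onto a subspace is a standard Gaussian
vector of that subspace. -/
theorem map_colProj_stdNormal [DecidableEq m] (K : Submodule ℝ (EuclideanSpace ℝ m)) (a : q) :
    (stdNormal m q).map (colProj K a) = stdGaussian K := by
  have : IsProbabilityMeasure ((stdNormal m q).map (colProj K a)) :=
    Measure.isProbabilityMeasure_map
      (colProj K a).continuous_of_finiteDimensional.measurable.aemeasurable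
  refine Measure.ext_of_charFun (funext fun t => ?_)
  rw [charFun_map_stdNormal, charFun_stdGaussian, Complex.ofReal_sum]
  congr 2
  rw [Submodule.coe_norm, ← Complex.ofReal_pow, EuclideanSpace.real_norm_sq_eq, Complex.ofReal_sum]
  congr 1
  refine Finset.sum_congr rfl fun i _ => ?_
  congr 1
  have h : ∀ b, ⟪colProj K a (Matrix.single i b 1), t⟫ =
      if b = a then (t : EuclideanSpace ℝ m) i else 0 := by
    intro b
    have h1 : ⟪colProj K a (Matrix.single i b 1), t⟫ =
        ⟪euclCol (Matrix.single i b (1 : ℝ)) a, (t : EuclideanSpace ℝ m)⟫ :=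
      Submodule.inner_orthogonalProjectionOnto_eq_of_mem_right t _
    rw [h1, euclCol, PiLp.inner_apply]
    by_cases hb : b = a
    · subst hb
      simp [Matrix.single_apply]
    · simp [hb]
  simp only [h]
  simp

theorem measurable_colProj (K : Submodule ℝ (EuclideanSpace ℝ m)) (a : q) :
    Measurable (colProj K a) :=
  (colProj K a).continuous_of_finiteDimensional.measurable

theorem ae_euclCol_notMem [DecidableEq m] (K : Submodule ℝ (EuclideanSpace ℝ m)) (a : q)
    (hK : Module.finrank ℝ K < Fintype.card m) : ∀ᵐ F ∂(stdNormal m q), euclCol F a ∉ K := by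
  have hd : 0 < Module.finrank ℝ Kᗮ := by
    have := K.finrank_add_finrank_orthogonal
    rw [finrank_euclideanSpace] at this
    omega
  have h := stdGaussian_singleton_zero hd
  rw [← map_colProj_stdNormal Kᗮ a, Measure.map_apply (measurable_colProj _ _)
    (measurableSet_singleton _)] at h
  refine measure_mono_null (fun F hF => ?_) h
  have hF' : euclCol F a ∈ K := by simpa using hF
  change Kᗮ.orthogonalProjectionOnto (euclCol F a) = 0
  rw [Submodule.orthogonalProjectionOnto_eq_zero_iff, Submodule.orthogonal_orthogonal]
  exact hF'

/-- The columns of `X` followed by those of `E`. -/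
def allCols (X : Matrix m ι ℝ) (E : Matrix m q ℝ) : ι ⊕ q → EuclideanSpace ℝ m :=
  Sum.elim (euclCol X) (euclCol E)

/-- Exchanging the components along the `a`-th coordinate of the responses replaces the `a`-th
column of `E` by that of `F`. -/
theorem exchange_col_apply [DecidableEq m] (E F : Matrix m q ℝ) (a : q) (i : m) (b : q) :
    (exchange 1 (Matrix.single a a 1) (E, F)).1 i b = if b = a then F i b else E i b := by
  change (E + (1 : Matrix m m ℝ) * (F - E) * Matrix.single a a (1 : ℝ)) i b = _
  rw [Matrix.one_mul, Matrix.add_apply]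
  by_cases hb : b = a
  · subst hb
    simp
  · simp [hb]

theorem euclCol_exchange_of_ne [DecidableEq m] (E F : Matrix m q ℝ) {a b : q} (hb : b ≠ a) :
    euclCol (exchange 1 (Matrix.single a a 1) (E, F)).1 b = euclCol E b := by
  simp [euclCol, exchange_col_apply, hb]

theorem euclCol_exchange_self [DecidableEq m] (E F : Matrix m q ℝ) (a : q) :
    euclCol (exchange 1 (Matrix.single a a 1) (E, F)).1 a = euclCol F a := by
  simp [euclCol, exchange_col_apply]

theorem colProj_exchange [DecidableEq m] (K : Submodule ℝ (EuclideanSpace ℝ m))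
    (E F : Matrix m q ℝ) (a : q) :
    colProj K a (exchange 1 (Matrix.single a a 1) (E, F)).1 = colProj K a F :=
  congrArg K.orthogonalProjectionOnto (euclCol_exchange_self E F a)

theorem allCols_exchange_of_ne [DecidableEq m] (X : Matrix m ι ℝ) (E F : Matrix m q ℝ) {a : q}
    {x : ι ⊕ q} (hx : x ≠ Sum.inr a) :
    allCols X (exchange 1 (Matrix.single a a 1) (E, F)).1 x = allCols X E x := by
  rcases x with i | b
  · rfl
  · exact euclCol_exchange_of_ne E F fun h => hx (h ▸ rfl)

theorem measurePreserving_exchange_col [DecidableEq m] (a : q) :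
    MeasurePreserving (exchange (1 : Matrix m m ℝ) (Matrix.single a a 1))
      ((stdNormal m q).prod (stdNormal m q)) ((stdNormal m q).prod (stdNormal m q)) :=
  measurePreserving_exchange (by simp) (by simp) (by simp) (by simp)

/-- Replacing a column of a standard normal matrix by that of an independent copy does not change
its law. -/
theorem measurePreserving_replaceCol [DecidableEq m] (a : q) :
    MeasurePreserving
      (fun z => (exchange (1 : Matrix m m ℝ) (Matrix.single a a (1 : ℝ)) z).1)
      ((stdNormal m q).prod (stdNormal m q)) (stdNormal m q) :=
  measurePreserving_fst.comp (measurePreserving_exchange_col a)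

theorem ae_of_measurePreserving {α β : Type*} [MeasurableSpace α] [MeasurableSpace β]
    {μ : Measure α} {ν : Measure β} {f : α → β} (hf : MeasurePreserving f μ ν) {p : β → Prop}
    (hp : MeasurableSet {y | p y}) (h : ∀ᵐ x ∂μ, p (f x)) : ∀ᵐ y ∂ν, p y := by
  rw [← hf.map_eq]
  exact (ae_map_iff hf.measurable.aemeasurable hp).mpr h

theorem continuous_euclCol (a : q) : Continuous fun E : Matrix m q ℝ => euclCol E a :=
  (PiLp.continuous_toLp 2 _).comp (by fun_prop)

theorem measurableSet_linearIndepOn_allCols (X : Matrix m ι ℝ) (s : Set (ι ⊕ q)) :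
    MeasurableSet {E : Matrix m q ℝ | LinearIndepOn ℝ (allCols X E) s} := by
  classical
  have h : {E : Matrix m q ℝ | LinearIndepOn ℝ (allCols X E) s} =
      {E | (Matrix.gram ℝ fun x : s => allCols X E x).det ≠ 0} := by
    ext E
    exact Matrix.det_gram_ne_zero_iff_linearIndependent.symm
  have hc : Continuous fun E : Matrix m q ℝ => (Matrix.gram ℝ fun x : s => allCols X E x).det := by
    refine Continuous.matrix_det (continuous_matrix fun x y => ?_)
    have hcol : ∀ x : ι ⊕ q, Continuous fun E : Matrix m q ℝ => allCols X E x := by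
      rintro (i | b)
      · exact continuous_const
      · exact continuous_euclCol b
    exact (hcol x).inner (hcol y)
  rw [h]
  exact (isOpen_ne_fun hc continuous_const).measurableSet

/-- Adjoining the columns one at a time, each new one avoids almost surely the span of the others:
independent columns of `X` and the columns of a standard normal matrix are almost surely linearly
independent. -/
theorem ae_linearIndependent_allCols [DecidableEq m] {X : Matrix m ι ℝ}
    (hX : LinearIndependent ℝ (euclCol X)) (hm : Fintype.card ι + Fintype.card q ≤ Fintype.card m) :
    ∀ᵐ E ∂(stdNormal m q), LinearIndependent ℝ (allCols X E) := by
  classical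
  have key : ∀ S : Finset q, ∀ᵐ E ∂(stdNormal m q),
      LinearIndepOn ℝ (allCols X E) (Set.range Sum.inl ∪ Sum.inr '' S) := by
    intro S
    induction S using Finset.induction_on with
    | empty =>
      refine ae_of_all _ fun E => ?_
      rw [Finset.coe_empty, Set.image_empty, Set.union_empty]
      exact (linearIndepOn_range_iff Sum.inl_injective _).mpr hX
    | insert a S ha ih =>
      set s : Set (ι ⊕ q) := Set.range Sum.inl ∪ Sum.inr '' S with hs
      have has : Sum.inr a ∉ s := by simp [hs, ha]
      have hins : Set.range Sum.inl ∪ Sum.inr '' (insert a S : Finset q) =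
          insert (Sum.inr a) s := by
        rw [hs, Finset.coe_insert, Set.image_insert_eq, Set.union_insert]
      rw [hins]
      have hms := measurableSet_linearIndepOn_allCols (q := q) X (insert (Sum.inr a) s)
      have hpre : ∀ᵐ z ∂((stdNormal m q).prod (stdNormal m q)), LinearIndepOn ℝ
          (allCols X (exchange 1 (Matrix.single a a 1) z).1) (insert (Sum.inr a) s) := by
        have hmeas : MeasurableSet {z | LinearIndepOn ℝ (allCols X
            (exchange (1 : Matrix m m ℝ) (Matrix.single a a 1) z).1) (insert (Sum.inr a) s)} :=
          (measurable_fst.comp (measurePreserving_exchange_col a).measurable) hms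
        rw [ae_iff, ← Set.compl_ofPred, Measure.measure_prod_null hmeas.compl]
        filter_upwards [ih] with E hE
        have hdim : Module.finrank ℝ (Submodule.span ℝ (allCols X E '' s)) < Fintype.card m := by
          have h1 : Module.finrank ℝ (Submodule.span ℝ (allCols X E '' s)) = s.ncard := by
            rw [Set.image_eq_range, finrank_span_eq_card hE, ← Nat.card_eq_fintype_card,
              Nat.card_coe_set_eq]
          have h2 : s.ncard < (Set.univ : Set (ι ⊕ q)).ncard :=
            Set.ncard_lt_ncard ⟨Set.subset_univ _, fun h => has (h (Set.mem_univ _))⟩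
          rw [Set.ncard_univ, Nat.card_eq_fintype_card, Fintype.card_sum] at h2
          omega
        refine (ae_euclCol_notMem _ a hdim).mono fun F hF => ?_
        rw [linearIndepOn_insert has]
        have heq : Set.EqOn (allCols X E)
            (allCols X (exchange 1 (Matrix.single a a 1) (E, F)).1) s :=
          fun x hx => (allCols_exchange_of_ne X E F fun h => has (h ▸ hx)).symm
        refine ⟨hE.congr heq, ?_⟩
        rw [← heq.image_eq]
        change euclCol _ a ∉ _
        rwa [euclCol_exchange_self]
      exact ae_of_measurePreserving (measurePreserving_replaceCol a) hms hpre
  filter_upwards [key Finset.univ] with E hE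
  rw [Finset.coe_univ, Set.image_univ, Set.range_inl_union_range_inr] at hE
  exact linearIndepOn_univ_iff.mp hE

end

section

variable {m ι q : Type*} [Fintype m] [Fintype ι] [Fintype q] [DecidableEq m] [DecidableEq ι]
  [DecidableEq q]

/-! ### The residual Gram matrix and the moments of its inverse -/

theorem transpose_projMat (X : Matrix m ι ℝ) : (projMat X)ᵀ = projMat X := by
  simp [projMat, Matrix.transpose_mul, Matrix.transpose_nonsing_inv, Matrix.mul_assoc]

theorem projMat_mul_self_design {X : Matrix m ι ℝ} (hX : (Xᵀ * X).det ≠ 0) :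
    projMat X * X = X := by
  rw [projMat, Matrix.mul_assoc, Matrix.mul_assoc, Matrix.nonsing_inv_mul _ hX.isUnit,
    Matrix.mul_one]

theorem projMat_mul_projMat {X : Matrix m ι ℝ} (hX : (Xᵀ * X).det ≠ 0) :
    projMat X * projMat X = projMat X := by
  have h : projMat X * projMat X = projMat X * X * ((Xᵀ * X)⁻¹ * Xᵀ) := by
    simp only [projMat, Matrix.mul_assoc]
  rw [h, projMat_mul_self_design hX, projMat, Matrix.mul_assoc]

theorem trace_projMat {X : Matrix m ι ℝ} (hX : (Xᵀ * X).det ≠ 0) :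
    (projMat X).trace = Fintype.card ι := by
  rw [projMat, Matrix.trace_mul_comm, ← Matrix.mul_assoc, Matrix.mul_nonsing_inv _ hX.isUnit,
    Matrix.trace_one]

theorem linearIndependent_euclCol {X : Matrix m ι ℝ} (hX : (Xᵀ * X).det ≠ 0) :
    LinearIndependent ℝ (euclCol X) := by
  have h : Matrix.gram ℝ (euclCol X) = Xᵀ * X := by
    ext i k
    rw [Matrix.gram_apply, inner_euclCol]
  rw [← Matrix.det_gram_ne_zero_iff_linearIndependent, h]
  exact hX

theorem sum_smul_euclCol {κ : Type*} [Fintype κ] (E : Matrix m κ ℝ) (v : κ → ℝ) :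
    ∑ c, v c • euclCol E c = WithLp.toLp 2 (E *ᵥ v) := by
  ext i
  simp [euclCol, Matrix.mulVec, dotProduct, mul_comm]

/-- The Gram matrix `Eᵀ(I - P)E` of the residuals of `E`. -/
def residGram (X : Matrix m ι ℝ) (E : Matrix m q ℝ) : Matrix q q ℝ :=
  Eᵀ * (1 - projMat X) * E

theorem mleCov_eq (X : Matrix m ι ℝ) (E : Matrix m q ℝ) :
    mleCov X E = (Fintype.card m : ℝ)⁻¹ • residGram X E := rfl

theorem residGram_eq {X : Matrix m ι ℝ} (hX : (Xᵀ * X).det ≠ 0) (E : Matrix m q ℝ) :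
    residGram X E = ((1 - projMat X) * E)ᵀ * ((1 - projMat X) * E) := by
  have h : (1 - projMat X) * (1 - projMat X) = 1 - projMat X := by
    rw [Matrix.mul_sub, Matrix.sub_mul, Matrix.sub_mul, projMat_mul_projMat hX]
    simp
  rw [Matrix.transpose_mul, Matrix.transpose_sub, transpose_projMat, Matrix.transpose_one,
    Matrix.mul_assoc, ← Matrix.mul_assoc (1 - projMat X), h, residGram, Matrix.mul_assoc]

theorem posDef_residGram {X : Matrix m ι ℝ} (hX : (Xᵀ * X).det ≠ 0) {E : Matrix m q ℝ}
    (hE : LinearIndependent ℝ (allCols X E)) : (residGram X E).PosDef := by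
  rw [residGram_eq hX]
  have hinj : Function.Injective ((1 - projMat X) * E).mulVec := by
    refine (injective_iff_map_eq_zero (Matrix.mulVecLin ((1 - projMat X) * E))).mpr fun v hv => ?_
    -- a residual that vanishes is a linear relation between the columns of `X` and of `E`
    have hv' : E *ᵥ v = X *ᵥ (((Xᵀ * X)⁻¹ * Xᵀ * E) *ᵥ v) := by
      rw [Matrix.mulVecLin_apply, Matrix.sub_mul, Matrix.one_mul, Matrix.sub_mulVec,
        sub_eq_zero] at hv
      rw [hv, projMat, Matrix.mulVec_mulVec]
      simp only [Matrix.mul_assoc]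
    have h := Fintype.linearIndependent_iff.mp hE
      (Sum.elim (-(((Xᵀ * X)⁻¹ * Xᵀ * E) *ᵥ v)) v) (by
        rw [Fintype.sum_sum_type]
        simp only [Sum.elim_inl, Sum.elim_inr, allCols, sum_smul_euclCol]
        rw [hv', Matrix.mulVec_neg, WithLp.toLp_neg, neg_add_cancel])
    exact funext fun c => h (Sum.inr c)
  have h := Matrix.PosDef.conjTranspose_mul_self ((1 - projMat X) * E) hinj
  rwa [Matrix.conjTranspose_eq_transpose_of_trivial] at h

/-- The orthogonal complement of the columns of `X` and of the columns of `E` other than the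
`a`-th. -/
def otherCompl (X : Matrix m ι ℝ) (E : Matrix m q ℝ) (a : q) :
    Submodule ℝ (EuclideanSpace ℝ m) :=
  (Submodule.span ℝ (allCols X E '' {Sum.inr a}ᶜ))ᗮ

theorem finrank_otherCompl {X : Matrix m ι ℝ} {E : Matrix m q ℝ}
    (hE : LinearIndependent ℝ (allCols X E)) (a : q) :
    Module.finrank ℝ (otherCompl X E a) + Fintype.card ι + Fintype.card q =
      Fintype.card m + 1 := by
  have h1 : Module.finrank ℝ (Submodule.span ℝ (allCols X E '' {Sum.inr a}ᶜ)) =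
      Fintype.card ι + Fintype.card q - 1 := by
    classical
    rw [Set.image_eq_range,
      finrank_span_eq_card (b := fun x : ({Sum.inr a}ᶜ : Set (ι ⊕ q)) => allCols X E x)
        (hE.comp _ Subtype.val_injective),
      ← Nat.card_eq_fintype_card, Nat.card_coe_set_eq, Set.ncard_compl, Set.ncard_singleton,
      Nat.card_eq_fintype_card, Fintype.card_sum]
  have h2 := Submodule.finrank_add_finrank_orthogonal
    (Submodule.span ℝ (allCols X E '' {Sum.inr a}ᶜ))
  have : 0 < Fintype.card q := Fintype.card_pos_iff.mpr ⟨a⟩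
  rw [finrank_euclideanSpace] at h2
  rw [otherCompl]
  omega

theorem otherCompl_exchange (X : Matrix m ι ℝ) (E F : Matrix m q ℝ) (a : q) :
    otherCompl X (exchange 1 (Matrix.single a a 1) (E, F)).1 a = otherCompl X E a := by
  rw [otherCompl, otherCompl]
  congr 2
  exact Set.image_congr fun x hx => allCols_exchange_of_ne X E F hx

/-- A diagonal entry of the inverse residual Gram matrix is the inverse squared distance of a
column to the span of the other columns and of the columns of `X`. -/
theorem inv_residGram_apply_self {X : Matrix m ι ℝ} (hX : (Xᵀ * X).det ≠ 0) {E : Matrix m q ℝ}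
    (hE : (residGram X E).PosDef) (a : q) :
    (residGram X E)⁻¹ a a = (‖colProj (otherCompl X E a) a E‖ ^ 2)⁻¹ := by
  set W := residGram X E with hW
  set w := W⁻¹ a a with hw
  have hu : IsUnit W.det := hE.det_pos.ne'.isUnit
  have hwpos : 0 < w := hE.inv.diag_pos
  have hWt : (W⁻¹)ᵀ = W⁻¹ := by simpa using hE.inv.isHermitian.eq
  -- the columns of `D` form the dual basis of the residuals
  set D : Matrix m q ℝ := (1 - projMat X) * E * W⁻¹ with hD
  have hXD : Xᵀ * D = 0 := by
    have : Xᵀ * projMat X = Xᵀ := by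
      conv_lhs => rw [← transpose_projMat, ← Matrix.transpose_mul, projMat_mul_self_design hX]
    rw [hD, ← Matrix.mul_assoc, ← Matrix.mul_assoc, Matrix.mul_sub, this]
    simp
  have hED : Eᵀ * D = 1 := by
    rw [hD, ← Matrix.mul_assoc, ← Matrix.mul_assoc]
    exact Matrix.mul_nonsing_inv _ hu
  have hDD : Dᵀ * D = W⁻¹ := by
    conv_lhs => rw [hD]
    rw [Matrix.transpose_mul, Matrix.mul_assoc, ← Matrix.mul_assoc _ _ W⁻¹, ← residGram_eq hX, hWt,
      Matrix.mul_nonsing_inv _ hu, Matrix.mul_one]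
  set b := euclCol D a with hb
  have hbb : ⟪b, b⟫ = w := by rw [hb, inner_euclCol, hDD]
  have hbmem : b ∈ otherCompl X E a := by
    rw [otherCompl, Submodule.mem_orthogonal]
    intro u hu
    induction hu using Submodule.span_induction with
    | mem u hu =>
      obtain ⟨x, hx, rfl⟩ := hu
      rcases x with i | c
      · change ⟪euclCol X i, b⟫ = 0
        rw [hb, inner_euclCol, hXD, Matrix.zero_apply]
      · change ⟪euclCol E c, b⟫ = 0
        rw [hb, inner_euclCol, hED, Matrix.one_apply_ne]
        exact fun h => hx (h ▸ rfl)
    | zero => simp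
    | add u v _ _ hu hv => rw [inner_add_left, hu, hv, add_zero]
    | smul c u _ hu => rw [inner_smul_left, hu, mul_zero]
  have hbsum : b = ∑ c, W⁻¹ c a • euclCol E c -
      ∑ k, ((Xᵀ * X)⁻¹ * Xᵀ * E * W⁻¹) k a • euclCol X k := by
    have : D = E * W⁻¹ - X * ((Xᵀ * X)⁻¹ * Xᵀ * E * W⁻¹) := by
      rw [hD, Matrix.sub_mul, Matrix.sub_mul, projMat]
      simp only [Matrix.one_mul, Matrix.mul_assoc]
    rw [sum_smul_euclCol, sum_smul_euclCol, ← WithLp.toLp_sub, hb, this]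
    rfl
  have hbu : ∀ u ∈ otherCompl X E a, ⟪b, u⟫ = w * ⟪euclCol E a, u⟫ := by
    intro u hu
    rw [otherCompl, Submodule.mem_orthogonal] at hu
    have hX0 : ∀ k, ⟪euclCol X k, u⟫ = 0 := fun k =>
      hu _ (Submodule.subset_span ⟨Sum.inl k, by simp, rfl⟩)
    have hE0 : ∀ c, c ≠ a → ⟪euclCol E c, u⟫ = 0 := fun c hc =>
      hu _ (Submodule.subset_span ⟨Sum.inr c, by simpa using hc, rfl⟩)
    rw [hbsum, inner_sub_left, sum_inner, sum_inner]
    simp only [real_inner_smul_left, hX0, mul_zero, Finset.sum_const_zero, sub_zero]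
    rw [Finset.sum_eq_single a (fun c _ hc => by rw [hE0 c hc, mul_zero]) (by simp)]
  -- `E a - w⁻¹ b` is orthogonal to the complement, to which `b` belongs
  have hproj : (otherCompl X E a).starProjection (euclCol E a) = w⁻¹ • b := by
    refine Submodule.eq_starProjection_of_mem_of_inner_eq_zero (Submodule.smul_mem _ _ hbmem)
      fun u hu => ?_
    rw [inner_sub_left, real_inner_smul_left, hbu u hu, inv_mul_cancel_left₀ hwpos.ne', sub_self]
  have hnorm : ‖colProj (otherCompl X E a) a E‖ ^ 2 = w⁻¹ := by
    rw [Submodule.coe_norm]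
    change ‖(otherCompl X E a).starProjection (euclCol E a)‖ ^ 2 = w⁻¹
    rw [hproj, ← real_inner_self_eq_norm_sq, real_inner_smul_left, real_inner_smul_right, hbb]
    field_simp
  rw [hnorm, inv_inv]

theorem measurable_inv_apply {α : Type*} [MeasurableSpace α] {f : α → Matrix q q ℝ}
    (hf : Measurable f) (a b : q) : Measurable fun x => (f x)⁻¹ a b := by
  have hdet : Measurable fun x => (f x).det :=
    (Continuous.matrix_det continuous_id).measurable.comp hf
  have hadj : Measurable fun x => (f x).adjugate :=
    (Continuous.matrix_adjugate continuous_id).measurable.comp hf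
  simp only [Matrix.inv_def, Matrix.smul_apply, Ring.inverse_eq_inv', smul_eq_mul]
  exact hdet.inv.mul ((measurable_entry a b).comp hadj)

theorem continuous_residGram (X : Matrix m ι ℝ) :
    Continuous fun E : Matrix m q ℝ => residGram X E := by
  unfold residGram
  fun_prop

theorem ae_linearIndependent_of_det_ne_zero {X : Matrix m ι ℝ} (hX : (Xᵀ * X).det ≠ 0)
    (hm : Fintype.card ι + Fintype.card q ≤ Fintype.card m) :
    ∀ᵐ E ∂(stdNormal m q), LinearIndependent ℝ (allCols X E) :=
  ae_linearIndependent_allCols (linearIndependent_euclCol hX) hm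

theorem ae_posDef_residGram {X : Matrix m ι ℝ} (hX : (Xᵀ * X).det ≠ 0)
    (hm : Fintype.card ι + Fintype.card q ≤ Fintype.card m) :
    ∀ᵐ E ∂(stdNormal m q), (residGram X E).PosDef :=
  (ae_linearIndependent_of_det_ne_zero hX hm).mono fun _ => posDef_residGram hX

/-- Conditionally on the other columns, the inverse of `(W⁻¹)ₐₐ` is the squared norm of a standard
Gaussian vector of a subspace of dimension `card m - card ι - card q + 1`. -/
theorem lintegral_inv_residGram_apply_self {X : Matrix m ι ℝ} (hX : (Xᵀ * X).det ≠ 0)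
    (hm : Fintype.card ι + Fintype.card q ≤ Fintype.card m) (a : q) {g : ℝ → ENNReal}
    (hg : Measurable g) {c : ENNReal}
    (hc : ∀ K : Submodule ℝ (EuclideanSpace ℝ m),
      Module.finrank ℝ K + Fintype.card ι + Fintype.card q = Fintype.card m + 1 →
      ∫⁻ x, g ((‖x‖ ^ 2)⁻¹) ∂(stdGaussian K) = c) :
    ∫⁻ E, g ((residGram X E)⁻¹ a a) ∂(stdNormal m q) = c := by
  have hmeas : Measurable fun E : Matrix m q ℝ => g ((residGram X E)⁻¹ a a) :=
    hg.comp (measurable_inv_apply (continuous_residGram X).measurable a a)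
  -- resampling the column `a` allows to integrate over it with the other columns fixed
  have hpres := measurePreserving_replaceCol (m := m) a
  rw [← hpres.map_eq, lintegral_map hmeas hpres.measurable,
    lintegral_prod (fun z => g ((residGram X (exchange (1 : Matrix m m ℝ)
      (Matrix.single a a (1 : ℝ)) z).1)⁻¹ a a)) (hmeas.comp hpres.measurable).aemeasurable]
  have hLI := ae_linearIndependent_of_det_ne_zero (q := q) hX hm
  have hpos := Measure.ae_ae_of_ae_prod (hpres.quasiMeasurePreserving.ae
    (ae_posDef_residGram (q := q) hX hm))
  have h : ∀ᵐ E ∂(stdNormal m q), ∫⁻ F, g ((residGram X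
      (exchange (1 : Matrix m m ℝ) (Matrix.single a a (1 : ℝ)) (E, F)).1)⁻¹ a a)
        ∂(stdNormal m q) = c := by
    filter_upwards [hLI, hpos] with E hE hE'
    rw [← hc (otherCompl X E a) (finrank_otherCompl hE a),
      ← map_colProj_stdNormal (otherCompl X E a) a, lintegral_map (by fun_prop)
        (measurable_colProj _ _)]
    refine lintegral_congr_ae (hE'.mono fun F hF => ?_)
    have h1 := inv_residGram_apply_self hX hF a
    simp only
    rw [h1, otherCompl_exchange]
    rw [colProj_exchange]
  rw [lintegral_congr_ae h, lintegral_const, measure_univ, mul_one]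

end

section

variable {m ι q : Type*} [Fintype m] [Fintype ι] [Fintype q] [DecidableEq m] [DecidableEq ι]
  [DecidableEq q]

theorem integrable_and_integral_of_lintegral {α : Type*} [MeasurableSpace α] {μ : Measure α}
    {f : α → ℝ} (hf : Measurable f) (h0 : 0 ≤ᵐ[μ] f) {c : ℝ} (hc : 0 ≤ c)
    (h : ∫⁻ x, ENNReal.ofReal (f x) ∂μ = ENNReal.ofReal c) :
    Integrable f μ ∧ ∫ x, f x ∂μ = c := by
  refine ⟨⟨hf.aestronglyMeasurable, ?_⟩, ?_⟩
  · rw [hasFiniteIntegral_iff_ofReal h0, h]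
    exact ENNReal.ofReal_lt_top
  · rw [integral_eq_lintegral_of_nonneg_ae h0 hf.aestronglyMeasurable, h, ENNReal.toReal_ofReal hc]

theorem measurable_inv_residGram_apply (X : Matrix m ι ℝ) (a b : q) :
    Measurable fun E : Matrix m q ℝ => (residGram X E)⁻¹ a b :=
  measurable_inv_apply (continuous_residGram X).measurable a b

theorem integral_inv_residGram_apply_self {X : Matrix m ι ℝ} (hX : (Xᵀ * X).det ≠ 0)
    (hm : Fintype.card ι + Fintype.card q + 4 ≤ Fintype.card m) (a : q) :
    Integrable (fun E => (residGram X E)⁻¹ a a) (stdNormal m q) ∧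
      ∫ E, (residGram X E)⁻¹ a a ∂(stdNormal m q) =
        1 / ((Fintype.card m : ℝ) - Fintype.card q - Fintype.card ι - 1) := by
  have hm' : (Fintype.card ι : ℝ) + Fintype.card q + 4 ≤ Fintype.card m := by exact_mod_cast hm
  refine integrable_and_integral_of_lintegral (measurable_inv_residGram_apply X a a)
    ((ae_posDef_residGram hX (by omega)).mono fun E hE => hE.inv.diag_pos.le)
    (one_div_nonneg.mpr (by linarith)) ?_
  refine lintegral_inv_residGram_apply_self hX (by omega) a (g := ENNReal.ofReal)
    ENNReal.measurable_ofReal fun K hK => ?_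
  rw [lintegral_inv_norm_sq_stdGaussian (by omega)]
  have hK' : (Module.finrank ℝ K : ℝ) + Fintype.card ι + Fintype.card q = Fintype.card m + 1 := by
    exact_mod_cast hK
  congr 2
  linarith

theorem integral_sq_inv_residGram_apply_self {X : Matrix m ι ℝ} (hX : (Xᵀ * X).det ≠ 0)
    (hm : Fintype.card ι + Fintype.card q + 4 ≤ Fintype.card m) (a : q) :
    Integrable (fun E => ((residGram X E)⁻¹ a a) ^ 2) (stdNormal m q) ∧
      ∫ E, ((residGram X E)⁻¹ a a) ^ 2 ∂(stdNormal m q) =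
        1 / (((Fintype.card m : ℝ) - Fintype.card q - Fintype.card ι - 1) *
          ((Fintype.card m : ℝ) - Fintype.card q - Fintype.card ι - 3)) := by
  have hm' : (Fintype.card ι : ℝ) + Fintype.card q + 4 ≤ Fintype.card m := by exact_mod_cast hm
  refine integrable_and_integral_of_lintegral ((measurable_inv_residGram_apply X a a).pow_const 2)
    (ae_of_all _ fun E => sq_nonneg _)
    (one_div_nonneg.mpr (mul_nonneg (by linarith) (by linarith))) ?_
  refine lintegral_inv_residGram_apply_self hX (by omega) a (g := fun x => ENNReal.ofReal (x ^ 2))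
    (by fun_prop) fun K hK => ?_
  rw [lintegral_inv_norm_sq_sq_stdGaussian (by omega)]
  have hK' : (Module.finrank ℝ K : ℝ) + Fintype.card ι + Fintype.card q = Fintype.card m + 1 := by
    exact_mod_cast hK
  congr 3 <;> linarith

/-- The expected trace of the inverse residual Gram matrix (an inverse Wishart matrix). -/
theorem integral_trace_inv_residGram {X : Matrix m ι ℝ} (hX : (Xᵀ * X).det ≠ 0)
    (hm : Fintype.card ι + Fintype.card q + 4 ≤ Fintype.card m) :
    Integrable (fun E => (residGram X E)⁻¹.trace) (stdNormal m q) ∧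
      ∫ E, (residGram X E)⁻¹.trace ∂(stdNormal m q) =
        Fintype.card q / ((Fintype.card m : ℝ) - Fintype.card q - Fintype.card ι - 1) := by
  have h := fun a : q => integral_inv_residGram_apply_self hX hm a
  simp only [Matrix.trace, Matrix.diag]
  refine ⟨integrable_finsetSum _ fun a _ => (h a).1, ?_⟩
  rw [integral_finsetSum _ fun a _ => (h a).1]
  simp only [(h _).2, Finset.sum_const, Finset.card_univ, nsmul_eq_mul, mul_one_div]

theorem integral_sq_trace_inv_residGram {X : Matrix m ι ℝ} (hX : (Xᵀ * X).det ≠ 0)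
    (hm : Fintype.card ι + Fintype.card q + 4 ≤ Fintype.card m) :
    Integrable (fun E => (residGram X E)⁻¹.trace ^ 2) (stdNormal m q) ∧
      ∫ E, (residGram X E)⁻¹.trace ^ 2 ∂(stdNormal m q) ≤ (Fintype.card q : ℝ) ^ 2 /
        (((Fintype.card m : ℝ) - Fintype.card q - Fintype.card ι - 1) *
          ((Fintype.card m : ℝ) - Fintype.card q - Fintype.card ι - 3)) := by
  have h := fun a : q => integral_sq_inv_residGram_apply_self hX hm a
  have hsum : Integrable (fun E => (Fintype.card q : ℝ) * ∑ a, ((residGram X E)⁻¹ a a) ^ 2)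
      (stdNormal m q) := (integrable_finsetSum _ fun a _ => (h a).1).const_mul _
  have hle : ∀ E : Matrix m q ℝ, (residGram X E)⁻¹.trace ^ 2 ≤
      (Fintype.card q : ℝ) * ∑ a, ((residGram X E)⁻¹ a a) ^ 2 := fun E =>
    sq_sum_le_card_mul_sum_sq
  have hint : Integrable (fun E => (residGram X E)⁻¹.trace ^ 2) (stdNormal m q) := by
    refine hsum.mono' (Measurable.aestronglyMeasurable ?_) (ae_of_all _ fun E => ?_)
    · exact (Finset.measurable_sum _ fun a _ => measurable_inv_residGram_apply X a a).pow_const 2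
    · rw [Real.norm_of_nonneg (sq_nonneg _)]
      exact hle E
  refine ⟨hint, (integral_mono hint hsum hle).trans_eq ?_⟩
  rw [integral_const_mul, integral_finsetSum _ fun a _ => (h a).1]
  simp only [(h _).2, Finset.sum_const, Finset.card_univ, nsmul_eq_mul]
  ring

/-! ### Linear and quadratic forms of a standard normal matrix -/

/-- The linear form `F ↦ ∑ C_{ia} F_{ia}`. -/
def linForm (C : Matrix m q ℝ) : Matrix m q ℝ →ₗ[ℝ] ℝ where
  toFun F := ∑ i, ∑ a, C i a * F i a
  map_add' := by intros; simp [mul_add, Finset.sum_add_distrib]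
  map_smul' := by intros; simp [Finset.mul_sum, mul_left_comm]

theorem linForm_apply (C F : Matrix m q ℝ) : linForm C F = ∑ i, ∑ a, C i a * F i a := rfl

/-- The sum of the squares of the entries of `C`, the variance of `linForm C`. -/
def sumSq (C : Matrix m q ℝ) : ℝ := ∑ i, ∑ a, C i a ^ 2

theorem sumSq_nonneg (C : Matrix m q ℝ) : 0 ≤ sumSq C :=
  Finset.sum_nonneg fun _ _ => Finset.sum_nonneg fun _ _ => sq_nonneg _

theorem measurePreserving_linForm (C : Matrix m q ℝ) :
    MeasurePreserving (linForm C) (stdNormal m q) (gaussianReal 0 (sumSq C).toNNReal) := by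
  have hL : Measurable (linForm C) := (linForm C).continuous_of_finiteDimensional.measurable
  refine ⟨hL, ?_⟩
  have := Measure.isProbabilityMeasure_map (μ := stdNormal m q) hL.aemeasurable
  refine Measure.ext_of_charFun (funext fun t => ?_)
  rw [charFun_map_stdNormal, charFun_gaussianReal, Real.coe_toNNReal _ (sumSq_nonneg C)]
  congr 1
  have h : ∀ i a, linForm C (Matrix.single i a 1) = C i a := by
    intro i a
    rw [linForm_apply, Finset.sum_eq_single i, Finset.sum_eq_single a]
    · simp
    · intro b _ hb; simp [hb.symm]
    · simp
    · intro k _ hk; simp [hk.symm]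
    · simp
  have h2 : ∑ i, ∑ a, ⟪linForm C (Matrix.single i a 1), t⟫ ^ 2 = sumSq C * t ^ 2 := by
    simp only [h, sumSq, Finset.sum_mul]
    refine Finset.sum_congr rfl fun i _ => Finset.sum_congr rfl fun a _ => ?_
    rw [RCLike.inner_apply, conj_trivial]
    ring
  rw [h2]
  push_cast
  ring

/-- The fourth moment of the standard normal law. -/
def gaussFour : ℝ := ∫ x, x ^ 4 ∂(gaussianReal 0 1)

theorem gaussFour_nonneg : 0 ≤ gaussFour := integral_nonneg fun x => by positivity

theorem integrable_pow_gaussianReal (v : NNReal) (k : ℕ) :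
    Integrable (fun x : ℝ => x ^ k) (gaussianReal 0 v) := by
  have h := (memLp_id_gaussianReal (μ := 0) (v := v) k).integrable_norm_pow'
  refine h.mono' (Measurable.aestronglyMeasurable (by fun_prop)) (ae_of_all _ fun x => ?_)
  simp

theorem integral_sq_gaussianReal (v : NNReal) : ∫ x, x ^ 2 ∂(gaussianReal 0 v) = v := by
  have h := variance_fun_id_gaussianReal (μ := 0) (v := v)
  rw [variance_of_integral_eq_zero (by fun_prop) integral_id_gaussianReal] at h
  exact h

theorem integral_four_gaussianReal (v : NNReal) :
    ∫ x, x ^ 4 ∂(gaussianReal 0 v) = gaussFour * v ^ 2 := by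
  have h : gaussianReal 0 v = (gaussianReal 0 1).map (fun x => √(v : ℝ) * x) := by
    rw [gaussianReal_map_const_mul, mul_zero, mul_one]
    congr 1
    ext
    simp
  rw [h, integral_map (by fun_prop) (Measurable.aestronglyMeasurable (by fun_prop))]
  simp only [mul_pow]
  rw [integral_const_mul, gaussFour, mul_comm]
  congr 1
  have := Real.sq_sqrt v.coe_nonneg
  rw [show √(v : ℝ) ^ 4 = (√(v : ℝ) ^ 2) ^ 2 by ring, this]

theorem integrable_linForm_pow (C : Matrix m q ℝ) (k : ℕ) :
    Integrable (fun F => linForm C F ^ k) (stdNormal m q) :=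
  (measurePreserving_linForm C).integrable_comp_of_integrable (integrable_pow_gaussianReal _ k)

theorem integral_comp_linForm (C : Matrix m q ℝ) {g : ℝ → ℝ} (hg : Measurable g) :
    ∫ F, g (linForm C F) ∂(stdNormal m q) = ∫ x, g x ∂(gaussianReal 0 (sumSq C).toNNReal) := by
  rw [← (measurePreserving_linForm C).map_eq,
    integral_map (measurePreserving_linForm C).measurable.aemeasurable hg.aestronglyMeasurable]

theorem integral_linForm (C : Matrix m q ℝ) : ∫ F, linForm C F ∂(stdNormal m q) = 0 := by
  rw [integral_comp_linForm C (g := fun x => x) measurable_id, integral_id_gaussianReal]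

theorem integral_linForm_sq (C : Matrix m q ℝ) :
    ∫ F, linForm C F ^ 2 ∂(stdNormal m q) = sumSq C := by
  rw [integral_comp_linForm C (g := fun x => x ^ 2) (by fun_prop), integral_sq_gaussianReal,
    Real.coe_toNNReal _ (sumSq_nonneg C)]

theorem integral_linForm_four (C : Matrix m q ℝ) :
    ∫ F, linForm C F ^ 4 ∂(stdNormal m q) = gaussFour * sumSq C ^ 2 := by
  rw [integral_comp_linForm C (g := fun x => x ^ 4) (by fun_prop), integral_four_gaussianReal,
    Real.coe_toNNReal _ (sumSq_nonneg C)]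

theorem linForm_eq_zero {C : Matrix m q ℝ} (hC : sumSq C = 0) (F : Matrix m q ℝ) :
    linForm C F = 0 := by
  have h1 := (Finset.sum_eq_zero_iff_of_nonneg fun i _ =>
    Finset.sum_nonneg fun a _ => sq_nonneg (C i a)).mp hC
  refine Finset.sum_eq_zero fun i hi => Finset.sum_eq_zero fun a ha => ?_
  have h2 := (Finset.sum_eq_zero_iff_of_nonneg fun a _ => sq_nonneg (C i a)).mp (h1 i hi) a ha
  rw [pow_eq_zero_iff two_ne_zero] at h2
  rw [h2, zero_mul]

/-- A sum of squares of linear forms has second moment at most a constant times the square of its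
mean. -/
theorem integral_sq_sum_linForm_sq {κ : Type*} (s : Finset κ) (C : κ → Matrix m q ℝ) :
    Integrable (fun F => (∑ k ∈ s, linForm (C k) F ^ 2) ^ 2) (stdNormal m q) ∧
    ∫ F, (∑ k ∈ s, linForm (C k) F ^ 2) ^ 2 ∂(stdNormal m q) ≤
      gaussFour * (∑ k ∈ s, sumSq (C k)) ^ 2 := by
  set V := ∑ k ∈ s, sumSq (C k) with hV
  -- Cauchy–Schwarz with weights `sumSq (C k)`; a form of zero variance vanishes identically
  have hle : ∀ F, (∑ k ∈ s, linForm (C k) F ^ 2) ^ 2 ≤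
      V * ∑ k ∈ s, linForm (C k) F ^ 4 / sumSq (C k) := fun F => by
    refine Finset.sum_sq_le_sum_mul_sum_of_sq_le_mul s (fun k _ => sumSq_nonneg _)
      (fun k _ => div_nonneg (by positivity) (sumSq_nonneg _)) fun k _ => le_of_eq ?_
    by_cases hk : sumSq (C k) = 0
    · simp [hk, linForm_eq_zero hk]
    · field_simp
  have hint : Integrable (fun F => V * ∑ k ∈ s, linForm (C k) F ^ 4 / sumSq (C k))
      (stdNormal m q) :=
    (integrable_finsetSum _ fun k _ => (integrable_linForm_pow (C k) 4).div_const _).const_mul _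
  have hint' : Integrable (fun F => (∑ k ∈ s, linForm (C k) F ^ 2) ^ 2) (stdNormal m q) := by
    refine hint.mono' (Measurable.aestronglyMeasurable ?_) (ae_of_all _ fun F => ?_)
    · exact (Finset.measurable_sum _ fun k _ =>
        (measurePreserving_linForm (C k)).measurable.pow_const 2).pow_const 2
    · rw [Real.norm_of_nonneg (sq_nonneg _)]
      exact hle F
  refine ⟨hint', (integral_mono hint' hint hle).trans_eq ?_⟩
  rw [integral_const_mul, integral_finsetSum _ fun k _ =>
    (integrable_linForm_pow (C k) 4).div_const _]
  have h : ∀ k, ∫ F, linForm (C k) F ^ 4 / sumSq (C k) ∂(stdNormal m q) =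
      gaussFour * sumSq (C k) := by
    intro k
    rw [integral_div, integral_linForm_four]
    by_cases hk : sumSq (C k) = 0
    · simp [hk]
    · field_simp
  simp only [h]
  rw [← Finset.mul_sum, ← hV]
  ring

open scoped MatrixOrder in
/-- A quadratic form `tr(A FᵀKF)`, with `A` positive semidefinite and `K` an orthogonal projection,
is a sum of squares of linear forms whose variances add up to `tr K tr A`. -/
theorem trace_quadratic_eq_sum {A : Matrix q q ℝ} (hA : A.PosSemidef) {K : Matrix m m ℝ}
    (hK : K * K = K) (hK' : Kᵀ = K) :
    ∃ C : m × q → Matrix m q ℝ,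
      (∀ F : Matrix m q ℝ, (A * (Fᵀ * K * F)).trace = ∑ x, linForm (C x) F ^ 2) ∧
        ∑ x, sumSq (C x) = K.trace * A.trace := by
  obtain ⟨B, hB⟩ := CStarAlgebra.nonneg_iff_eq_star_mul_self.mp hA.nonneg
  rw [Matrix.star_eq_conjTranspose, Matrix.conjTranspose_eq_transpose_of_trivial] at hB
  have hKtr : ∑ i, ∑ k, K i k ^ 2 = K.trace := by
    rw [← trace_transpose_mul_self, hK', hK]
  have hAtr : ∑ b, ∑ l, B b l ^ 2 = A.trace := by
    rw [← trace_transpose_mul_self, hB]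
  -- for `A = BᵀB` the form is the sum of the squared entries of `K F Bᵀ`
  refine ⟨fun x => Matrix.of fun k l => K x.1 k * B x.2 l, fun F => ?_, ?_⟩
  · have h1 : (A * (Fᵀ * K * F)).trace = ((K * F * Bᵀ)ᵀ * (K * F * Bᵀ)).trace := by
      have : (K * F * Bᵀ)ᵀ * (K * F * Bᵀ) = B * (Fᵀ * K * F * Bᵀ) := by
        simp only [Matrix.transpose_mul, Matrix.transpose_transpose, hK', Matrix.mul_assoc]
        rw [← Matrix.mul_assoc K K, hK]
      rw [this, hB, Matrix.mul_assoc Bᵀ, Matrix.trace_mul_comm Bᵀ]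
      simp only [Matrix.mul_assoc]
    rw [h1, trace_transpose_mul_self, Fintype.sum_prod_type]
    refine Finset.sum_congr rfl fun i _ => Finset.sum_congr rfl fun b _ => ?_
    congr 1
    rw [linForm_apply, Matrix.mul_apply, Finset.sum_comm]
    refine Finset.sum_congr rfl fun l _ => ?_
    rw [Matrix.mul_apply, Finset.sum_mul]
    refine Finset.sum_congr rfl fun k _ => ?_
    simp only [Matrix.transpose_apply, Matrix.of_apply]
    ring
  · simp only [sumSq, Matrix.of_apply, mul_pow, ← Finset.mul_sum, ← Finset.sum_mul]
    rw [Fintype.sum_prod_type]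
    simp only [← Finset.mul_sum, ← Finset.sum_mul]
    rw [hKtr, hAtr]

end

section

variable {m ι q : Type*} [Fintype m] [Fintype ι] [Fintype q] [DecidableEq m] [DecidableEq ι]
  [DecidableEq q]

/-! ### Quadratic forms in two independent standard normal matrices -/

theorem integral_trace_quadratic {A : Matrix q q ℝ} (hA : A.PosSemidef) {K : Matrix m m ℝ}
    (hK : K * K = K) (hK' : Kᵀ = K) :
    Integrable (fun F => (A * (Fᵀ * K * F)).trace) (stdNormal m q) ∧
      ∫ F, (A * (Fᵀ * K * F)).trace ∂(stdNormal m q) = K.trace * A.trace := by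
  obtain ⟨C, hC, hC'⟩ := trace_quadratic_eq_sum hA hK hK'
  simp only [hC]
  refine ⟨integrable_finsetSum _ fun x _ => integrable_linForm_pow _ 2, ?_⟩
  rw [integral_finsetSum _ fun x _ => integrable_linForm_pow _ 2]
  simp only [integral_linForm_sq, hC']

theorem integral_sq_trace_quadratic {A : Matrix q q ℝ} (hA : A.PosSemidef) {K : Matrix m m ℝ}
    (hK : K * K = K) (hK' : Kᵀ = K) :
    Integrable (fun F => (A * (Fᵀ * K * F)).trace ^ 2) (stdNormal m q) ∧
      ∫ F, (A * (Fᵀ * K * F)).trace ^ 2 ∂(stdNormal m q) ≤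
        gaussFour * (K.trace * A.trace) ^ 2 := by
  obtain ⟨C, hC, hC'⟩ := trace_quadratic_eq_sum hA hK hK'
  simp only [hC, ← hC']
  exact integral_sq_sum_linForm_sq _ C

theorem trace_quadratic_nonneg {A : Matrix q q ℝ} (hA : A.PosSemidef) {K : Matrix m m ℝ}
    (hK : K * K = K) (hK' : Kᵀ = K) (F : Matrix m q ℝ) : 0 ≤ (A * (Fᵀ * K * F)).trace := by
  obtain ⟨C, hC, -⟩ := trace_quadratic_eq_sum hA hK hK'
  rw [hC]
  exact Finset.sum_nonneg fun _ _ => sq_nonneg _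

/-- The quadratic form `tr(W(E)⁻¹ FᵀKF)`, where `W(E)` is the residual Gram matrix of `E`. -/
def wForm (X : Matrix m ι ℝ) (K : Matrix m m ℝ) (z : Matrix m q ℝ × Matrix m q ℝ) : ℝ :=
  ((residGram X z.1)⁻¹ * (z.2ᵀ * K * z.2)).trace

theorem measurable_inv_residGram (X : Matrix m ι ℝ) :
    Measurable fun E : Matrix m q ℝ => (residGram X E)⁻¹ :=
  measurable_matrix fun a b => measurable_inv_residGram_apply X a b

theorem measurable_trace_mul {α : Type*} [MeasurableSpace α] {f g : α → Matrix q q ℝ}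
    (hf : Measurable f) (hg : Measurable g) : Measurable fun x => (f x * g x).trace := by
  simp only [Matrix.trace, Matrix.diag, Matrix.mul_apply]
  exact Finset.measurable_sum _ fun a _ => Finset.measurable_sum _ fun b _ =>
    ((measurable_entry a b).comp hf).mul ((measurable_entry b a).comp hg)

theorem measurable_trace_inv_residGram_mul (X : Matrix m ι ℝ)
    {g : Matrix m q ℝ × Matrix m q ℝ → Matrix q q ℝ} (hg : Continuous g) :
    Measurable fun z : Matrix m q ℝ × Matrix m q ℝ => ((residGram X z.1)⁻¹ * g z).trace :=
  measurable_trace_mul ((measurable_inv_residGram X).comp measurable_fst)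
    (measurable_matrix fun a b => (hg.matrix_elem a b).measurable)

theorem measurable_wForm (X : Matrix m ι ℝ) (K : Matrix m m ℝ) :
    Measurable (wForm (q := q) X K) :=
  measurable_trace_inv_residGram_mul X (by fun_prop)

/-- Tonelli's theorem with an integrable bound on the inner integral. -/
theorem integrable_prod_of_nonneg_of_integral_le {α β : Type*} [MeasurableSpace α]
    [MeasurableSpace β] {μ : Measure α} {ν : Measure β} [SFinite μ] [SFinite ν] {f : α × β → ℝ}
    (hf : Measurable f) (h0 : ∀ᵐ x ∂μ, ∀ y, 0 ≤ f (x, y))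
    (hint : ∀ᵐ x ∂μ, Integrable (fun y => f (x, y)) ν) {g : α → ℝ} (hg : Integrable g μ)
    (hle : ∀ᵐ x ∂μ, ∫ y, f (x, y) ∂ν ≤ g x) :
    Integrable f (μ.prod ν) ∧ ∫ z, f z ∂(μ.prod ν) ≤ ∫ x, g x ∂μ := by
  have hmeas : AEStronglyMeasurable (fun x => ∫ y, f (x, y) ∂ν) μ :=
    hf.stronglyMeasurable.integral_prod_right'.aestronglyMeasurable
  have hI : Integrable (fun x => ∫ y, f (x, y) ∂ν) μ := by
    refine hg.mono' hmeas ?_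
    filter_upwards [h0, hle] with x h0 hle
    rwa [Real.norm_of_nonneg (integral_nonneg h0)]
  have hf' : Integrable f (μ.prod ν) := by
    rw [integrable_prod_iff hf.aestronglyMeasurable]
    refine ⟨hint, hI.congr ?_⟩
    filter_upwards [h0] with x h0
    exact integral_congr_ae (ae_of_all _ fun y => (Real.norm_of_nonneg (h0 y)).symm)
  refine ⟨hf', ?_⟩
  rw [integral_prod _ hf']
  exact integral_mono_ae hI hg hle

/-- The joint law of two independent standard normal matrices. -/
def stdPair (m q : Type*) [Fintype m] [Fintype q] [DecidableEq q] :
    Measure (Matrix m q ℝ × Matrix m q ℝ) :=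
  (stdNormal m q).prod (stdNormal m q)

instance : IsProbabilityMeasure (stdPair m q) :=
  (inferInstance : IsProbabilityMeasure ((stdNormal m q).prod (stdNormal m q)))

theorem ae_stdPair_of_ae_fst {p : Matrix m q ℝ → Prop} (h : ∀ᵐ E ∂(stdNormal m q), p E) :
    ∀ᵐ z ∂(stdPair m q), p z.1 :=
  (measurePreserving_fst (μ := stdNormal m q) (ν := stdNormal m q)).quasiMeasurePreserving.ae h

theorem integral_wForm {X : Matrix m ι ℝ} (hX : (Xᵀ * X).det ≠ 0)
    (hm : Fintype.card ι + Fintype.card q + 4 ≤ Fintype.card m) {K : Matrix m m ℝ}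
    (hK : K * K = K) (hK' : Kᵀ = K) :
    Integrable (wForm (q := q) X K) (stdPair m q) ∧
      ∫ z, wForm (q := q) X K z ∂(stdPair m q) =
        K.trace * (Fintype.card q /
          ((Fintype.card m : ℝ) - Fintype.card q - Fintype.card ι - 1)) := by
  have hpos : ∀ᵐ E ∂(stdNormal m q), ((residGram X E)⁻¹).PosSemidef :=
    (ae_posDef_residGram hX (by omega)).mono fun E hE => hE.inv.posSemidef
  obtain ⟨h1, h2⟩ := integral_trace_inv_residGram (q := q) hX hm
  have heq : ∀ᵐ E ∂(stdNormal m q), ∫ F, wForm X K (E, F) ∂(stdNormal m q) =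
      K.trace * (residGram X E)⁻¹.trace :=
    hpos.mono fun E hE => (integral_trace_quadratic hE hK hK').2
  have hint : Integrable (wForm (q := q) X K) (stdPair m q) :=
    (integrable_prod_of_nonneg_of_integral_le (measurable_wForm X K)
      (hpos.mono fun E hE F => trace_quadratic_nonneg hE hK hK' F)
      (hpos.mono fun E hE => (integral_trace_quadratic hE hK hK').1)
      (h1.const_mul K.trace) (heq.mono fun E hE => hE.le)).1
  refine ⟨hint, ?_⟩
  rw [stdPair, integral_prod _ hint, integral_congr_ae heq, integral_const_mul, h2]

theorem integral_sq_wForm {X : Matrix m ι ℝ} (hX : (Xᵀ * X).det ≠ 0)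
    (hm : Fintype.card ι + Fintype.card q + 4 ≤ Fintype.card m) {K : Matrix m m ℝ}
    (hK : K * K = K) (hK' : Kᵀ = K) :
    Integrable (fun z => wForm (q := q) X K z ^ 2) (stdPair m q) ∧
      ∫ z, wForm (q := q) X K z ^ 2 ∂(stdPair m q) ≤
        gaussFour * K.trace ^ 2 * ((Fintype.card q : ℝ) ^ 2 /
          (((Fintype.card m : ℝ) - Fintype.card q - Fintype.card ι - 1) *
            ((Fintype.card m : ℝ) - Fintype.card q - Fintype.card ι - 3))) := by
  have hpos : ∀ᵐ E ∂(stdNormal m q), ((residGram X E)⁻¹).PosSemidef :=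
    (ae_posDef_residGram hX (by omega)).mono fun E hE => hE.inv.posSemidef
  obtain ⟨h1, h2⟩ := integral_sq_trace_inv_residGram (q := q) hX hm
  obtain ⟨h3, h4⟩ := integrable_prod_of_nonneg_of_integral_le (ν := stdNormal m q)
    ((measurable_wForm (q := q) X K).pow_const 2)
    (ae_of_all _ fun E F => sq_nonneg _)
    (hpos.mono fun E hE => (integral_sq_trace_quadratic hE hK hK').1)
    (h1.const_mul (gaussFour * K.trace ^ 2)) (hpos.mono fun E hE => by
      refine (integral_sq_trace_quadratic hE hK hK').2.trans_eq ?_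
      ring)
  refine ⟨h3, h4.trans ?_⟩
  rw [integral_const_mul]
  have := gaussFour_nonneg
  gcongr

/-- The quadratic form `tr(W(E)⁻¹ EᵀPE)`, where `P` is the projection onto the columns of `X`. -/
def fitForm (X : Matrix m ι ℝ) (z : Matrix m q ℝ × Matrix m q ℝ) : ℝ :=
  ((residGram X z.1)⁻¹ * (z.1ᵀ * projMat X * z.1)).trace

/-- Exchanging the fitted parts of `E` and `F` keeps the residuals of `E`; since it preserves the
joint law, the fitted part of `E` may be replaced by that of the independent matrix `F`. -/
theorem wForm_exchange {X : Matrix m ι ℝ} (hX : (Xᵀ * X).det ≠ 0)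
    (z : Matrix m q ℝ × Matrix m q ℝ) :
    wForm X (projMat X) (exchange (projMat X) 1 z) = fitForm X z := by
  obtain ⟨E, F⟩ := z
  have hP := projMat_mul_projMat hX
  have hP' := transpose_projMat X
  have h1 : (1 - projMat X) * (E + projMat X * (F - E)) = (1 - projMat X) * E := by
    rw [Matrix.mul_add, ← Matrix.mul_assoc, Matrix.sub_mul 1 _ (projMat X), hP]
    simp
  have h2 : projMat X * (F - projMat X * (F - E)) = projMat X * E := by
    rw [Matrix.mul_sub, ← Matrix.mul_assoc, hP, Matrix.mul_sub]
    abel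
  have hsq : ∀ G : Matrix m q ℝ, Gᵀ * projMat X * G = (projMat X * G)ᵀ * (projMat X * G) := by
    intro G
    rw [Matrix.transpose_mul, hP', Matrix.mul_assoc, Matrix.mul_assoc, ← Matrix.mul_assoc
      (projMat X) (projMat X), hP]
  change ((residGram X (E + projMat X * (F - E) * (1 : Matrix q q ℝ)))⁻¹ *
    ((F - projMat X * (F - E) * (1 : Matrix q q ℝ))ᵀ * projMat X *
      (F - projMat X * (F - E) * (1 : Matrix q q ℝ)))).trace = _
  rw [Matrix.mul_one, hsq, h2, residGram_eq hX, h1, ← residGram_eq hX, ← hsq]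
  rfl

theorem measurePreserving_exchange_projMat {X : Matrix m ι ℝ} (hX : (Xᵀ * X).det ≠ 0) :
    MeasurePreserving (exchange (projMat X) (1 : Matrix q q ℝ)) (stdPair m q) (stdPair m q) :=
  measurePreserving_exchange (projMat_mul_projMat hX) (transpose_projMat X) (by simp) (by simp)

theorem integral_comp_fitForm {X : Matrix m ι ℝ} (hX : (Xᵀ * X).det ≠ 0) {g : ℝ → ℝ}
    (hg : Measurable g) (hint : Integrable (fun z => g (wForm (q := q) X (projMat X) z))
      (stdPair m q)) :
    Integrable (fun z => g (fitForm (q := q) X z)) (stdPair m q) ∧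
      ∫ z, g (fitForm (q := q) X z) ∂(stdPair m q) =
        ∫ z, g (wForm (q := q) X (projMat X) z) ∂(stdPair m q) := by
  have hpres := measurePreserving_exchange_projMat (q := q) hX
  simp only [← wForm_exchange hX]
  refine ⟨hpres.integrable_comp_of_integrable hint, ?_⟩
  have h := integral_map (μ := stdPair m q) hpres.measurable.aemeasurable
    (f := fun z => g (wForm (q := q) X (projMat X) z))
    (hg.comp (measurable_wForm X (projMat X))).aestronglyMeasurable
  rw [hpres.map_eq] at h
  exact h.symm

/-- The cross term `tr(W(E)⁻¹ FᵀPE)`. -/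
def crossForm (X : Matrix m ι ℝ) (z : Matrix m q ℝ × Matrix m q ℝ) : ℝ :=
  ((residGram X z.1)⁻¹ * (z.2ᵀ * projMat X * z.1)).trace

theorem measurable_crossForm (X : Matrix m ι ℝ) : Measurable (crossForm (q := q) X) :=
  measurable_trace_inv_residGram_mul X (by fun_prop)

theorem trace_cross_comm {A : Matrix q q ℝ} (hA : Aᵀ = A) {K : Matrix m m ℝ} (hK : Kᵀ = K)
    (E F : Matrix m q ℝ) : (A * (Eᵀ * K * F)).trace = (A * (Fᵀ * K * E)).trace := by
  rw [← Matrix.trace_transpose, Matrix.transpose_mul, Matrix.transpose_mul, Matrix.transpose_mul,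
    Matrix.transpose_transpose, hK, hA, Matrix.trace_mul_comm, Matrix.mul_assoc Fᵀ]

theorem trace_quadratic_add {A : Matrix q q ℝ} (hA : Aᵀ = A) {K : Matrix m m ℝ} (hK : Kᵀ = K)
    (E F : Matrix m q ℝ) : (A * ((F + E)ᵀ * K * (F + E))).trace =
      (A * (Fᵀ * K * F)).trace + 2 * (A * (Fᵀ * K * E)).trace + (A * (Eᵀ * K * E)).trace := by
  have h := trace_cross_comm hA hK E F
  simp only [Matrix.transpose_add, Matrix.add_mul, Matrix.mul_add, Matrix.trace_add, h]
  ring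

theorem trace_quadratic_sub {A : Matrix q q ℝ} (hA : Aᵀ = A) {K : Matrix m m ℝ} (hK : Kᵀ = K)
    (E F : Matrix m q ℝ) : (A * ((F - E)ᵀ * K * (F - E))).trace =
      (A * (Fᵀ * K * F)).trace - 2 * (A * (Fᵀ * K * E)).trace + (A * (Eᵀ * K * E)).trace := by
  have h := trace_cross_comm hA hK E F
  simp only [Matrix.transpose_sub, Matrix.sub_mul, Matrix.mul_sub, Matrix.trace_sub, h]
  ring

theorem trace_mul_transpose (C F : Matrix m q ℝ) : (C * Fᵀ).trace = linForm C F := by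
  simp [Matrix.trace, Matrix.mul_apply, linForm_apply]

theorem integral_crossForm {X : Matrix m ι ℝ} (hX : (Xᵀ * X).det ≠ 0)
    (hm : Fintype.card ι + Fintype.card q + 4 ≤ Fintype.card m) :
    Integrable (crossForm (q := q) X) (stdPair m q) ∧
      ∫ z, crossForm (q := q) X z ∂(stdPair m q) = 0 := by
  have hP := projMat_mul_projMat hX
  have hP' := transpose_projMat X
  have h1 := (integral_wForm (q := q) hX hm hP hP').1
  have h2 := (integral_comp_fitForm (q := q) hX (g := fun x => x) measurable_id h1).1
  -- the cross term is dominated by the sum of the two quadratic forms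
  have hint : Integrable (crossForm (q := q) X) (stdPair m q) := by
    refine (h1.add h2).mono' (measurable_crossForm X).aestronglyMeasurable ?_
    filter_upwards [ae_stdPair_of_ae_fst (ae_posDef_residGram (q := q) hX (by omega))] with z hz
    have hs := hz.inv.posSemidef
    have ht : ((residGram X z.1)⁻¹)ᵀ = (residGram X z.1)⁻¹ := by simpa using hs.isHermitian.eq
    have ha := trace_quadratic_nonneg hs hP hP' (z.2 + z.1)
    have hb := trace_quadratic_nonneg hs hP hP' (z.2 - z.1)
    have hc := trace_quadratic_nonneg hs hP hP' z.1
    have hd := trace_quadratic_nonneg hs hP hP' z.2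
    rw [trace_quadratic_add ht hP'] at ha
    rw [trace_quadratic_sub ht hP'] at hb
    rw [Real.norm_eq_abs, abs_le]
    simp only [crossForm, Pi.add_apply, wForm, fitForm]
    constructor <;> linarith
  refine ⟨hint, ?_⟩
  rw [stdPair, integral_prod _ hint]
  -- it is linear in `F`
  have h : ∀ E : Matrix m q ℝ, ∫ F, crossForm X (E, F) ∂(stdNormal m q) = 0 := by
    intro E
    rw [← integral_linForm (projMat X * E * (residGram X E)⁻¹)]
    refine integral_congr_ae (ae_of_all _ fun F => ?_)
    simp only [crossForm]
    rw [Matrix.trace_mul_comm, Matrix.mul_assoc, Matrix.mul_assoc, Matrix.trace_mul_comm,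
      ← trace_mul_transpose]
    simp only [Matrix.mul_assoc]
  simp only [h, integral_zero]

/-- The expected loss of the plug-in Gaussian density, up to scaling:
the mean of `tr(W(E)⁻¹ (F - PE)ᵀ(F - PE))` is `q (m + r) / (m - q - r - 1)`, where `m`, `q` and `r`
stand for the numbers of rows of `E`, of columns of `E` and of columns of `X`. -/
theorem integral_lossForm {X : Matrix m ι ℝ} (hX : (Xᵀ * X).det ≠ 0)
    (hm : Fintype.card ι + Fintype.card q + 4 ≤ Fintype.card m) :
    Integrable (fun z : Matrix m q ℝ × Matrix m q ℝ =>
      wForm X 1 z - 2 * crossForm X z + fitForm X z) (stdPair m q) ∧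
    ∫ z : Matrix m q ℝ × Matrix m q ℝ, wForm X 1 z - 2 * crossForm X z + fitForm X z ∂(stdPair m q)
      = ((Fintype.card m : ℝ) + Fintype.card ι) * (Fintype.card q /
          ((Fintype.card m : ℝ) - Fintype.card q - Fintype.card ι - 1)) := by
  have hP := projMat_mul_projMat hX
  have hP' := transpose_projMat X
  obtain ⟨h1, h1'⟩ := integral_wForm (q := q) hX hm (K := 1) (by simp) (by simp)
  obtain ⟨h2, h2'⟩ := integral_wForm (q := q) hX hm hP hP'
  obtain ⟨h3, h3'⟩ := integral_comp_fitForm (q := q) hX (g := fun x => x) measurable_id h2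
  obtain ⟨h4, h4'⟩ := integral_crossForm (q := q) hX hm
  refine ⟨(h1.sub (h4.const_mul 2)).add h3, ?_⟩
  rw [integral_add (f := fun z => wForm X 1 z - 2 * crossForm X z) (h1.sub (h4.const_mul 2)) h3,
    integral_sub (g := fun z => 2 * crossForm X z) h1 (h4.const_mul 2),
    integral_const_mul, h4', h3', h2', h1', trace_projMat hX, Matrix.trace_one]
  ring

/-- The quadratic form `tr(W(E)⁻¹ (F - E)ᵀP(F - E))`. -/
def gapForm (X : Matrix m ι ℝ) (z : Matrix m q ℝ × Matrix m q ℝ) : ℝ :=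
  ((residGram X z.1)⁻¹ * ((z.2 - z.1)ᵀ * projMat X * (z.2 - z.1))).trace

theorem measurable_gapForm (X : Matrix m ι ℝ) : Measurable (gapForm (q := q) X) :=
  measurable_trace_inv_residGram_mul X (by fun_prop)

theorem integral_sq_gapForm {X : Matrix m ι ℝ} (hX : (Xᵀ * X).det ≠ 0)
    (hm : Fintype.card ι + Fintype.card q + 4 ≤ Fintype.card m) :
    Integrable (fun z => gapForm (q := q) X z ^ 2) (stdPair m q) ∧
      ∫ z, gapForm (q := q) X z ^ 2 ∂(stdPair m q) ≤
        16 * (gaussFour * (Fintype.card ι : ℝ) ^ 2 * ((Fintype.card q : ℝ) ^ 2 /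
          (((Fintype.card m : ℝ) - Fintype.card q - Fintype.card ι - 1) *
            ((Fintype.card m : ℝ) - Fintype.card q - Fintype.card ι - 3)))) := by
  have hP := projMat_mul_projMat hX
  have hP' := transpose_projMat X
  obtain ⟨h1, h1'⟩ := integral_sq_wForm (q := q) hX hm hP hP'
  obtain ⟨h2, h2'⟩ := integral_comp_fitForm (q := q) hX (g := fun x => x ^ 2) (by fun_prop) h1
  have hsum := (h1.add h2).const_mul 8
  have hle : ∀ᵐ z ∂(stdPair m q), gapForm (q := q) X z ^ 2 ≤
      8 * (wForm X (projMat X) z ^ 2 + fitForm X z ^ 2) := by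
    filter_upwards [ae_stdPair_of_ae_fst (ae_posDef_residGram (q := q) hX (by omega))] with z hz
    have hs := hz.inv.posSemidef
    have ht : ((residGram X z.1)⁻¹)ᵀ = (residGram X z.1)⁻¹ := by simpa using hs.isHermitian.eq
    have ha := trace_quadratic_nonneg hs hP hP' (z.2 + z.1)
    have hb := trace_quadratic_nonneg hs hP hP' (z.2 - z.1)
    have hab : gapForm X z ≤ 2 * (wForm X (projMat X) z + fitForm X z) := by
      rw [trace_quadratic_add ht hP'] at ha
      rw [gapForm, trace_quadratic_sub ht hP']
      simp only [wForm, fitForm]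
      linarith
    have hb' : 0 ≤ gapForm X z := hb
    have := sq_nonneg (wForm X (projMat X) z - fitForm X z)
    nlinarith [mul_self_le_mul_self hb' hab]
  have hint : Integrable (fun z => gapForm (q := q) X z ^ 2) (stdPair m q) := by
    refine hsum.mono' ((measurable_gapForm X).pow_const 2).aestronglyMeasurable ?_
    filter_upwards [hle] with z hz
    rw [Real.norm_of_nonneg (sq_nonneg _)]
    exact hz
  refine ⟨hint, (integral_mono_ae hint hsum hle).trans ?_⟩
  simp only [Pi.add_apply]
  rw [integral_const_mul, integral_add h1 h2, h2']
  rw [trace_projMat hX] at h1'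
  linarith

end

section

variable {m ι q : Type*} [Fintype m] [Fintype ι] [Fintype q] [DecidableEq q]

/-! ### Square roots of positive definite matrices -/

open scoped MatrixOrder in
theorem exists_posDef_mul_self_eq {S : Matrix q q ℝ} (hS : S.PosDef) :
    ∃ R : Matrix q q ℝ, R.PosDef ∧ R * R = S := by
  have h := CFC.sqrt_mul_sqrt_self S hS.posSemidef.nonneg
  refine ⟨CFC.sqrt S, ?_, h⟩
  rw [(CFC.sqrt_nonneg S).posSemidef.posDef_iff_det_ne_zero]
  intro h0
  have := hS.det_pos
  rw [← h, Matrix.det_mul, h0, mul_zero] at this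
  exact lt_irrefl _ this

open scoped MatrixOrder in
theorem eq_of_mul_self_eq_mul_self {R R' : Matrix q q ℝ} (hR : R.PosSemidef)
    (hR' : R'.PosSemidef) (h : R * R = R' * R') : R = R' := by
  rw [← CFC.sqrt_unique (a := R' * R') h hR.nonneg, CFC.sqrt_unique rfl hR'.nonneg]

instance instPolishSpaceMatrix (m q : Type*) [Fintype m] [Fintype q] :
    PolishSpace (Matrix m q ℝ) :=
  (inferInstance : PolishSpace (m → q → ℝ))

theorem isClosed_setOf_posSemidef : IsClosed {R : Matrix q q ℝ | R.PosSemidef} := by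
  have h : {R : Matrix q q ℝ | R.PosSemidef} =
      {R | Rᴴ = R} ∩ ⋂ x : q → ℝ, {R | 0 ≤ star x ⬝ᵥ (R *ᵥ x)} := by
    ext R
    simp only [Set.mem_ofPred_eq, Set.mem_inter_iff, Set.mem_iInter]
    exact ⟨fun hR => ⟨hR.isHermitian, hR.dotProduct_mulVec_nonneg⟩,
      fun hR => Matrix.PosSemidef.of_dotProduct_mulVec_nonneg hR.1 hR.2⟩
  rw [h]
  refine (isClosed_eq (by fun_prop) continuous_id).inter (isClosed_iInter fun x => ?_)
  exact isClosed_le continuous_const (by fun_prop)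

/-- The positive semidefinite square root is measurable: squaring is continuous and injective on
positive semidefinite matrices. -/
theorem exists_measurable_sqrt (q : Type*) [Fintype q] [DecidableEq q] :
    ∃ σ : Matrix q q ℝ → Matrix q q ℝ, Measurable σ ∧
      ∀ R : Matrix q q ℝ, R.PosDef → σ (R * R) = R := by
  have hemb := ContinuousOn.measurableEmbedding (s := {R : Matrix q q ℝ | R.PosSemidef})
    (f := fun R => R * R) isClosed_setOf_posSemidef.measurableSet (by fun_prop)
    fun R hR R' hR' h => eq_of_mul_self_eq_mul_self hR hR' h
  obtain ⟨σ, hσ, hσ'⟩ := hemb.exists_measurable_extend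
    (g := fun R => (R : Matrix q q ℝ)) measurable_subtype_coe fun _ => ⟨0⟩
  exact ⟨σ, hσ, fun R hR => congrFun hσ' ⟨R, hR.posSemidef⟩⟩

/-! ### Bounds on the marginal likelihood -/

theorem lintegral_exp_neg_half_trace (m q : Type*) [Fintype m] [Fintype q] [DecidableEq q] :
    ∫⁻ E, ENNReal.ofReal (Real.exp (-(1 / 2) * (Eᵀ * E).trace)) ∂(matVolume m q) =
      ENNReal.ofReal ((2 * Real.pi) ^ ((Fintype.card m : ℝ) * Fintype.card q / 2)) := by
  have h1 : (stdNormal m q) Set.univ = 1 := measure_univ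
  have hpi : (0 : ℝ) < 2 * Real.pi := by positivity
  rw [stdNormal, matNormal, withDensity_apply _ MeasurableSet.univ, Measure.restrict_univ] at h1
  have h2 : ∀ E : Matrix m q ℝ, ENNReal.ofReal (Real.exp (-(1 / 2) * (Eᵀ * E).trace)) =
      ENNReal.ofReal ((2 * Real.pi) ^ ((Fintype.card m : ℝ) * Fintype.card q / 2)) *
        ENNReal.ofReal (matNormalPDF E 0 1) := by
    intro E
    rw [← ENNReal.ofReal_mul (by positivity)]
    congr 1
    simp only [matNormalPDF, sub_zero, inv_one, Matrix.one_mul, Matrix.det_one, Real.one_rpow,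
      mul_one]
    rw [← mul_assoc, ← Real.rpow_add hpi, add_neg_cancel, Real.rpow_zero, one_mul]
  simp only [h2]
  rw [lintegral_const_mul _ (measurable_matNormalPDF 0 1).ennreal_ofReal, h1, mul_one]

/-- The Gaussian integral over the regression coefficients. -/
theorem lintegral_exp_neg_half_quadratic [DecidableEq ι] {A : Matrix ι ι ℝ} (hA : A.PosDef)
    {S : Matrix q q ℝ} (hS : S.PosDef) (Θ₀ : Matrix ι q ℝ) :
    ∫⁻ Θ, ENNReal.ofReal (Real.exp (-(1 / 2) * (S⁻¹ * ((Θ - Θ₀)ᵀ * A * (Θ - Θ₀))).trace))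
      ∂(matVolume ι q) =
    ENNReal.ofReal ((2 * Real.pi) ^ ((Fintype.card ι : ℝ) * Fintype.card q / 2) *
      A.det ^ (-((Fintype.card q : ℝ) / 2)) * S.det ^ ((Fintype.card ι : ℝ) / 2)) := by
  obtain ⟨R, hR, hRS⟩ := exists_posDef_mul_self_eq hS
  obtain ⟨B, hB, hBA⟩ := exists_posDef_mul_self_eq hA
  have hRdet := hR.det_pos
  have hBdet := hB.det_pos
  have hRu : IsUnit R.det := hRdet.ne'.isUnit
  have hBu : IsUnit B.det := hBdet.ne'.isUnit
  have hRt : Rᵀ = R := by simpa using hR.isHermitian.eq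
  have hBt : (B⁻¹)ᵀ = B⁻¹ := by simpa using hB.inv.isHermitian.eq
  have hmeas : Measurable fun Θ : Matrix ι q ℝ =>
      ENNReal.ofReal (Real.exp (-(1 / 2) * (S⁻¹ * ((Θ - Θ₀)ᵀ * A * (Θ - Θ₀))).trace)) :=
    (Continuous.measurable (by fun_prop)).ennreal_ofReal
  rw [lintegral_matVolume_affine Θ₀ (B := B⁻¹) (C := R)
    (by rw [Matrix.det_nonsing_inv, Ring.inverse_eq_inv']; positivity) hRdet.ne' _ hmeas]
  have h : ∀ E : Matrix ι q ℝ, (S⁻¹ * ((Θ₀ + B⁻¹ * E * R - Θ₀)ᵀ * A *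
      (Θ₀ + B⁻¹ * E * R - Θ₀))).trace = (Eᵀ * E).trace := by
    intro E
    have hBAB : B⁻¹ * (B * (B * (B⁻¹ * (E * R)))) = E * R := by
      rw [← Matrix.mul_assoc B B⁻¹, Matrix.mul_nonsing_inv _ hBu, Matrix.one_mul,
        ← Matrix.mul_assoc B⁻¹ B, Matrix.nonsing_inv_mul _ hBu, Matrix.one_mul]
    rw [add_sub_cancel_left, ← hBA, ← hRS, Matrix.mul_inv_rev, Matrix.transpose_mul,
      Matrix.transpose_mul, hRt, hBt]
    simp only [Matrix.mul_assoc]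
    rw [hBAB, ← Matrix.mul_assoc R⁻¹ R, Matrix.nonsing_inv_mul _ hRu, Matrix.one_mul,
      Matrix.trace_mul_comm, Matrix.mul_assoc, Matrix.mul_assoc, Matrix.mul_nonsing_inv _ hRu,
      Matrix.mul_one]
  simp only [h]
  rw [lintegral_exp_neg_half_trace, ← ENNReal.ofReal_mul (by positivity),
    Real.rpow_neg (hA.det_pos.le), det_rpow_half hR hRS, det_rpow_half hB hBA,
    Matrix.det_nonsing_inv, Ring.inverse_eq_inv', abs_inv, abs_of_pos hRdet, abs_of_pos hBdet,
    inv_pow]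
  congr 1
  ring

variable [DecidableEq m] [DecidableEq ι]

theorem posDef_transpose_mul_self {X : Matrix m ι ℝ} (hX : (Xᵀ * X).det ≠ 0) :
    (Xᵀ * X).PosDef := by
  have h := Matrix.posSemidef_conjTranspose_mul_self X
  rw [Matrix.conjTranspose_eq_transpose_of_trivial] at h
  exact h.posDef_iff_det_ne_zero.mpr hX

theorem mul_mleCoef (X : Matrix m ι ℝ) (Y : Matrix m q ℝ) : X * mleCoef X Y = projMat X * Y := by
  simp only [mleCoef, projMat, Matrix.mul_assoc]

/-- The likelihood at `Θ` in terms of the likelihood at the maximum likelihood estimator. -/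
theorem matNormalPDF_eq_mul_exp {X : Matrix m ι ℝ} (hX : (Xᵀ * X).det ≠ 0) (Z : Matrix m q ℝ)
    (Θ : Matrix ι q ℝ) (S : Matrix q q ℝ) :
    matNormalPDF Z (X * Θ) S = matNormalPDF Z (X * mleCoef X Z) S * Real.exp (-(1 / 2) *
      (S⁻¹ * ((Θ - mleCoef X Z)ᵀ * (Xᵀ * X) * (Θ - mleCoef X Z))).trace) := by
  have h0 : Xᵀ * (Z - X * mleCoef X Z) = 0 := by
    rw [Matrix.mul_sub, mleCoef, ← Matrix.mul_assoc, ← Matrix.mul_assoc, ← Matrix.mul_assoc,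
      Matrix.mul_nonsing_inv _ hX.isUnit, Matrix.one_mul, sub_self]
  have h0' : (Z - X * mleCoef X Z)ᵀ * X = 0 := by
    rw [← Matrix.transpose_transpose X, ← Matrix.transpose_mul]
    simp [h0]
  have h : (Z - X * Θ)ᵀ * (Z - X * Θ) = (Z - X * mleCoef X Z)ᵀ * (Z - X * mleCoef X Z) +
      (Θ - mleCoef X Z)ᵀ * (Xᵀ * X) * (Θ - mleCoef X Z) := by
    have hd : Z - X * Θ = (Z - X * mleCoef X Z) - X * (Θ - mleCoef X Z) := by
      rw [Matrix.mul_sub]; abel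
    rw [hd]
    generalize Z - X * mleCoef X Z = U at h0 h0'
    generalize Θ - mleCoef X Z = D
    rw [Matrix.transpose_sub, Matrix.sub_mul, Matrix.mul_sub, Matrix.mul_sub,
      ← Matrix.mul_assoc _ X, h0', Matrix.transpose_mul, Matrix.mul_assoc _ Xᵀ U, h0]
    simp [Matrix.mul_assoc]
  simp only [matNormalPDF]
  rw [h, Matrix.mul_add, Matrix.trace_add, mul_add, Real.exp_add, mul_assoc, mul_assoc, mul_assoc]

theorem matNormalPDF_pos (Y M : Matrix m q ℝ) {S : Matrix q q ℝ} (hS : S.PosDef) :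
    0 < matNormalPDF Y M S := by
  have := hS.det_pos
  unfold matNormalPDF
  positivity

/-- The likelihood of `Z` at its own estimator, relative to that at the estimator of `Y`. -/
theorem matNormalPDF_mleCoef {X : Matrix m ι ℝ} (hX : (Xᵀ * X).det ≠ 0) (Y Z : Matrix m q ℝ)
    (S : Matrix q q ℝ) :
    matNormalPDF Z (X * mleCoef X Z) S = matNormalPDF Z (X * mleCoef X Y) S * Real.exp ((1 / 2) *
      (S⁻¹ * ((Z - Y)ᵀ * projMat X * (Z - Y))).trace) := by
  have h : (mleCoef X Y - mleCoef X Z)ᵀ * (Xᵀ * X) * (mleCoef X Y - mleCoef X Z) =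
      (Z - Y)ᵀ * projMat X * (Z - Y) := by
    have h1 : X * (mleCoef X Y - mleCoef X Z) = - (projMat X * (Z - Y)) := by
      rw [Matrix.mul_sub, mul_mleCoef, mul_mleCoef, Matrix.mul_sub]; abel
    rw [← Matrix.mul_assoc, ← Matrix.transpose_mul, Matrix.mul_assoc, h1, Matrix.transpose_neg,
      Matrix.transpose_mul, transpose_projMat, Matrix.neg_mul, Matrix.mul_neg, neg_neg,
      Matrix.mul_assoc, ← Matrix.mul_assoc (projMat X), projMat_mul_projMat hX, Matrix.mul_assoc]
  rw [matNormalPDF_eq_mul_exp hX Z (mleCoef X Y) S, h, mul_assoc, ← Real.exp_add]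
  simp

/-- The scale family property turns a bound at the identity into one at every scale. -/
theorem prior_le {π : Matrix ι q ℝ → Matrix q q ℝ → ℝ} (hscale : IsScaleFamily π) {c : ℝ}
    (hc : ∀ Θ, π Θ 1 ≤ c) {S : Matrix q q ℝ} (hS : S.PosDef) (Θ : Matrix ι q ℝ) :
    π Θ S ≤ c * S.det ^ (-((Fintype.card ι : ℝ) / 2)) := by
  obtain ⟨R, hR, hRS⟩ := exists_posDef_mul_self_eq hS
  have h := hscale S R hS hR hRS Θ
  have hdet := hS.det_pos
  rw [Real.rpow_neg hdet.le, ← div_eq_mul_inv, le_div_iff₀ (by positivity), h]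
  exact hc _

theorem smoothMarginal_nonneg {π : Matrix ι q ℝ → Matrix q q ℝ → ℝ} (hπ : IsPriorDensity π)
    (X : Matrix m ι ℝ) (Z : Matrix m q ℝ) {S : Matrix q q ℝ} (hS : S.PosDef) :
    0 ≤ smoothMarginal π X Z S :=
  integral_nonneg fun Θ => mul_nonneg (matNormalPDF_nonneg _ _ hS) ((hπ S hS).1 Θ)

/-- The smooth part of the marginal likelihood is at most a multiple of the maximal likelihood. -/
theorem smoothMarginal_le {π : Matrix ι q ℝ → Matrix q q ℝ → ℝ} (hπ : IsPriorDensity π)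
    (hscale : IsScaleFamily π) {c : ℝ} (hc : ∀ Θ, π Θ 1 ≤ c) {X : Matrix m ι ℝ}
    (hX : (Xᵀ * X).det ≠ 0) (Z : Matrix m q ℝ) {S : Matrix q q ℝ} (hS : S.PosDef) :
    smoothMarginal π X Z S ≤ matNormalPDF Z (X * mleCoef X Z) S *
      ((2 * Real.pi) ^ ((Fintype.card ι : ℝ) * Fintype.card q / 2) *
        (Xᵀ * X).det ^ (-((Fintype.card q : ℝ) / 2)) * c) := by
  have hA := posDef_transpose_mul_self hX
  have hAdet := hA.det_pos
  have hdet := hS.det_pos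
  set f : Matrix ι q ℝ → ℝ := fun Θ => Real.exp (-(1 / 2) *
      (S⁻¹ * ((Θ - mleCoef X Z)ᵀ * (Xᵀ * X) * (Θ - mleCoef X Z))).trace) with hf
  obtain ⟨h1, h2⟩ := integrable_and_integral_of_lintegral (f := f)
    (Continuous.measurable (by fun_prop)) (ae_of_all _ fun _ => (Real.exp_pos _).le)
    (by positivity) (lintegral_exp_neg_half_quadratic hA hS (mleCoef X Z))
  have hle : ∀ Θ, matNormalPDF Z (X * Θ) S * π Θ S ≤ matNormalPDF Z (X * mleCoef X Z) S *
      (c * S.det ^ (-((Fintype.card ι : ℝ) / 2))) * f Θ := by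
    intro Θ
    rw [matNormalPDF_eq_mul_exp hX, mul_right_comm]
    have hp := matNormalPDF_nonneg Z (X * mleCoef X Z) hS
    have hπΘ := prior_le hscale hc hS Θ
    gcongr
  refine (integral_mono_of_nonneg (ae_of_all _ fun Θ => mul_nonneg (matNormalPDF_nonneg _ _ hS)
    ((hπ S hS).1 Θ)) (h1.const_mul _) (ae_of_all _ hle)).trans_eq ?_
  rw [integral_const_mul, h2, Real.rpow_neg hdet.le]
  field_simp

end

section

variable {m ι q : Type*} [Fintype m] [Fintype ι] [Fintype q] [DecidableEq m] [DecidableEq ι]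
  [DecidableEq q]

/-! ### The loss gap -/

/-- The contribution of the smooth part of the prior to the predictive density at `Z`, relative to
that of the atom. -/
def priorRatio (π : Matrix ι q ℝ → Matrix q q ℝ → ℝ) (X : Matrix m ι ℝ) (w : ℝ)
    (Y Z : Matrix m q ℝ) : ℝ :=
  (1 - w) / w * (smoothMarginal π X Z (mleCov X Y) /
    matNormalPDF Z (X * mleCoef X Y) (mleCov X Y))

/-- A ratio that is at most `a exp (Q / 2)` with `a` exponentially small in `b` has a small logarithm
unless `Q` exceeds `b`, in which case the logarithm is at most `1 + Q / 2`. -/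
theorem log_one_add_le_of_le_mul_exp {ρ a b Q : ℝ} (hρ : 0 ≤ ρ) (hb : 0 < b) (hQ : 0 ≤ Q)
    (ha : a ≤ Real.exp (-b)) (h : ρ ≤ a * Real.exp (1 / 2 * Q)) :
    Real.log (1 + ρ) ≤ Real.exp (-(b / 2)) + (1 / b ^ 2 + 1 / (2 * b)) * Q ^ 2 := by
  have h1 : ρ ≤ Real.exp (-b + 1 / 2 * Q) := by
    rw [Real.exp_add]
    exact h.trans (by gcongr)
  rcases le_or_gt Q b with hQb | hQb
  · have h2 : Real.log (1 + ρ) ≤ ρ := by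
      have := Real.log_le_sub_one_of_pos (show 0 < 1 + ρ by positivity)
      linarith
    have h3 : Real.exp (-b + 1 / 2 * Q) ≤ Real.exp (-(b / 2)) := Real.exp_le_exp.mpr (by linarith)
    have : 0 ≤ (1 / b ^ 2 + 1 / (2 * b)) * Q ^ 2 := by positivity
    linarith
  · have h2 : 1 + ρ ≤ Real.exp (1 + 1 / 2 * Q) := by
      have h3 : Real.exp (-b + 1 / 2 * Q) ≤ Real.exp (1 / 2 * Q) :=
        Real.exp_le_exp.mpr (by linarith)
      have h4 : 1 ≤ Real.exp (1 / 2 * Q) := Real.one_le_exp (by positivity)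
      have h5 : (2 : ℝ) ≤ Real.exp 1 := by
        have := Real.add_one_le_exp (1 : ℝ); linarith
      rw [Real.exp_add]
      nlinarith [Real.exp_pos (1 / 2 * Q)]
    have h3 : Real.log (1 + ρ) ≤ 1 + 1 / 2 * Q := by
      rw [Real.log_le_iff_le_exp (by positivity)]
      exact h2
    have h4 : 1 ≤ 1 / b ^ 2 * Q ^ 2 := by
      rw [one_div, ← div_eq_inv_mul, le_div_iff₀ (by positivity), one_mul]
      gcongr
    have h5 : 1 / 2 * Q ≤ 1 / (2 * b) * Q ^ 2 := by
      have : 1 / (2 * b) * Q ^ 2 - 1 / 2 * Q = Q * (Q - b) / (2 * b) := by field_simp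
      have h6 : 0 ≤ Q * (Q - b) / (2 * b) :=
        div_nonneg (mul_nonneg hQ (by linarith)) (by positivity)
      linarith
    have := Real.exp_pos (-(b / 2))
    linarith

/-- The difference of Gaussian log-likelihoods in the loss gap, plus the effect of the smooth part
of the prior. -/
theorem lossGap_eq {π : Matrix ι q ℝ → Matrix q q ℝ → ℝ} (hπ : IsPriorDensity π)
    (X : Matrix m ι ℝ) {w : ℝ} (hw : 0 < w) (hw1 : w < 1) {Y : Matrix m q ℝ}
    (hY : (mleCov X Y).PosDef) (Z : Matrix m q ℝ) :
    lossGap π X w (Y, Z) =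
      ((mleCov X Y)⁻¹ * ((Z - X * mleCoef X Y)ᵀ * (Z - X * mleCoef X Y))).trace -
      ((mleCov X Y)⁻¹ * ((Y - X * mleCoef X Y)ᵀ * (Y - X * mleCoef X Y))).trace +
      (2 * Real.log (1 + priorRatio π X w Y Y) - 2 * Real.log (1 + priorRatio π X w Y Z)) := by
  have hlog : ∀ Z : Matrix m q ℝ, Real.log (predictive π X w Y Z) =
      Real.log w + Real.log ((2 * Real.pi) ^ (-((Fintype.card m : ℝ) * (Fintype.card q : ℝ) / 2))
        * (mleCov X Y).det ^ (-((Fintype.card m : ℝ) / 2))) +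
      -(1 / 2) * ((mleCov X Y)⁻¹ * ((Z - X * mleCoef X Y)ᵀ * (Z - X * mleCoef X Y))).trace +
      Real.log (1 + priorRatio π X w Y Z) := by
    intro Z
    have hpdf := matNormalPDF_pos Z (X * mleCoef X Y) hY
    have hs := smoothMarginal_nonneg hπ X Z hY
    have hdet := hY.det_pos
    have hρ : 0 ≤ priorRatio π X w Y Z :=
      mul_nonneg (div_nonneg (by linarith) hw.le) (div_nonneg hs hpdf.le)
    have h1 : predictive π X w Y Z =
        w * matNormalPDF Z (X * mleCoef X Y) (mleCov X Y) * (1 + priorRatio π X w Y Z) := by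
      rw [predictive, mixtureMarginal, priorRatio]
      field_simp
      ring
    rw [h1, Real.log_mul (by positivity) (by positivity), Real.log_mul hw.ne' hpdf.ne',
      matNormalPDF, Real.log_mul (by positivity) (Real.exp_pos _).ne', Real.log_exp]
    ring
  simp only [lossGap, hlog]
  ring

theorem priorRatio_nonneg {π : Matrix ι q ℝ → Matrix q q ℝ → ℝ} (hπ : IsPriorDensity π)
    (X : Matrix m ι ℝ) {w : ℝ} (hw : 0 < w) (hw1 : w < 1) {Y : Matrix m q ℝ}
    (hY : (mleCov X Y).PosDef) (Z : Matrix m q ℝ) : 0 ≤ priorRatio π X w Y Z :=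
  mul_nonneg (div_nonneg (by linarith) hw.le)
    (div_nonneg (smoothMarginal_nonneg hπ X Z hY) (matNormalPDF_pos _ _ hY).le)

/-- The contribution of the smooth part is at most `a exp(Q / 2)`, where `Q` measures the distance
between the fits of `Y` and `Z`. -/
theorem priorRatio_le {π : Matrix ι q ℝ → Matrix q q ℝ → ℝ} (hπ : IsPriorDensity π)
    (hscale : IsScaleFamily π) {c : ℝ} (hc : ∀ Θ, π Θ 1 ≤ c) {X : Matrix m ι ℝ}
    (hX : (Xᵀ * X).det ≠ 0) {w : ℝ} (hw : 0 < w) (hw1 : w < 1) {Y : Matrix m q ℝ}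
    (hY : (mleCov X Y).PosDef) (Z : Matrix m q ℝ) :
    priorRatio π X w Y Z ≤ ((1 - w) / w *
      ((2 * Real.pi) ^ ((Fintype.card ι : ℝ) * Fintype.card q / 2) *
        (Xᵀ * X).det ^ (-((Fintype.card q : ℝ) / 2)) * c)) * Real.exp (1 / 2 *
      ((mleCov X Y)⁻¹ * ((Z - Y)ᵀ * projMat X * (Z - Y))).trace) := by
  have hpdf := matNormalPDF_pos Z (X * mleCoef X Y) hY
  have h := smoothMarginal_le hπ hscale hc hX Z hY
  rw [matNormalPDF_mleCoef hX Y Z] at h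
  have hw' : 0 ≤ (1 - w) / w := div_nonneg (by linarith) hw.le
  rw [priorRatio, mul_assoc]
  refine mul_le_mul_of_nonneg_left ?_ hw'
  rw [div_le_iff₀ hpdf]
  exact h.trans_eq (by ring)

/-- Without regressors the smooth part of the prior rescales the atom. -/
theorem priorRatio_eq_of_isEmpty [IsEmpty ι] {π : Matrix ι q ℝ → Matrix q q ℝ → ℝ}
    (X : Matrix m ι ℝ) (w : ℝ) {Y : Matrix m q ℝ} (hY : (mleCov X Y).PosDef)
    (Z : Matrix m q ℝ) :
    priorRatio π X w Y Z = (1 - w) / w * π 0 (mleCov X Y) := by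
  have hpdf := matNormalPDF_pos Z (X * mleCoef X Y) hY
  have hvol : matVolume ι q = Measure.dirac 0 := by
    rw [matVolume, volume_pi, Measure.pi_of_empty _ 0]
    rfl
  have h0 : mleCoef X Y = 0 := Subsingleton.elim _ _
  rw [h0] at hpdf
  rw [priorRatio, smoothMarginal, hvol, integral_dirac, h0, mul_div_cancel_left₀ _ hpdf.ne']

/-- A jointly measurable version of the predictive density. -/
theorem exists_measurable_predictive {π : Matrix ι q ℝ → Matrix q q ℝ → ℝ}
    (hπ : IsPriorDensity π) (hscale : IsScaleFamily π) (X : Matrix m ι ℝ) (w : ℝ) :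
    ∃ g : Matrix m q ℝ × Matrix m q ℝ → ℝ, Measurable g ∧
      ∀ z, (mleCov X z.1).PosDef → predictive π X w z.1 z.2 = g z := by
  obtain ⟨σ, hσ, hσ'⟩ := exists_measurable_sqrt q
  have hcov : Measurable fun Y : Matrix m q ℝ => mleCov X Y :=
    Continuous.measurable (by simp only [mleCov]; fun_prop)
  have hdet : Measurable fun S : Matrix q q ℝ => S.det :=
    (Continuous.matrix_det continuous_id).measurable
  have hinv : ∀ {f : (Matrix m q ℝ × Matrix q q ℝ) × Matrix ι q ℝ → Matrix q q ℝ},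
      Measurable f → Measurable fun x => (f x)⁻¹ := fun hf =>
    measurable_matrix fun a b => measurable_inv_apply hf a b
  -- the Gaussian density is measurable in all its arguments
  have hpdf : Measurable fun x : (Matrix m q ℝ × Matrix q q ℝ) × Matrix ι q ℝ =>
      matNormalPDF x.1.1 (X * x.2) x.1.2 := by
    have hS : Measurable fun x : (Matrix m q ℝ × Matrix q q ℝ) × Matrix ι q ℝ => x.1.2 :=
      measurable_snd.comp measurable_fst
    have hq : Measurable fun x : (Matrix m q ℝ × Matrix q q ℝ) × Matrix ι q ℝ =>
        (x.1.1 - X * x.2)ᵀ * (x.1.1 - X * x.2) := Continuous.measurable (by fun_prop)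
    exact ((measurable_const.mul ((hdet.comp hS).pow_const _)).mul
      ((measurable_trace_mul (hinv hS) hq).const_mul _).exp)
  set h : (Matrix m q ℝ × Matrix q q ℝ) × Matrix ι q ℝ → ℝ := fun x =>
    matNormalPDF x.1.1 (X * x.2) x.1.2 *
      (π (x.2 * (σ x.1.2)⁻¹) 1 / x.1.2.det ^ ((Fintype.card ι : ℝ) / 2)) with hh
  have hmeas : Measurable h := by
    have hS : Measurable fun x : (Matrix m q ℝ × Matrix q q ℝ) × Matrix ι q ℝ => x.1.2 :=
      measurable_snd.comp measurable_fst
    have harg : Measurable fun x : (Matrix m q ℝ × Matrix q q ℝ) × Matrix ι q ℝ =>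
        x.2 * (σ x.1.2)⁻¹ := by
      refine measurable_matrix fun i a => ?_
      simp only [Matrix.mul_apply]
      exact Finset.measurable_sum _ fun b _ => ((measurable_entry i b).comp measurable_snd).mul
        (measurable_inv_apply (hσ.comp hS) b a)
    exact hpdf.mul (((hπ 1 Matrix.PosDef.one).2.comp harg).div ((hdet.comp hS).pow_const _))
  have hsm : Measurable fun x : Matrix m q ℝ × Matrix q q ℝ => ∫ Θ, h (x, Θ) ∂(matVolume ι q) :=
    hmeas.stronglyMeasurable.integral_prod_right'.measurable
  have hsm' : ∀ (Z : Matrix m q ℝ) {S : Matrix q q ℝ}, S.PosDef →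
      smoothMarginal π X Z S = ∫ Θ, h ((Z, S), Θ) ∂(matVolume ι q) := by
    intro Z S hS
    obtain ⟨R, hR, hRS⟩ := exists_posDef_mul_self_eq hS
    have hdetS := hS.det_pos
    refine integral_congr_ae (ae_of_all _ fun Θ => ?_)
    simp only [hh]
    have hσS : σ S = R := by rw [← hRS]; exact hσ' R hR
    rw [hσS, ← hscale S R hS hR hRS Θ, mul_div_cancel_right₀]
    positivity
  have hpair : Measurable fun z : Matrix m q ℝ × Matrix m q ℝ => (z.2, mleCov X z.1) :=
    measurable_snd.prodMk (hcov.comp measurable_fst)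
  have hcoef : Measurable fun z : Matrix m q ℝ × Matrix m q ℝ =>
      ((z.2, mleCov X z.1), mleCoef X z.1) :=
    hpair.prodMk (Continuous.measurable (by simp only [mleCoef]; fun_prop))
  refine ⟨fun z => (1 - w) * ∫ Θ, h ((z.2, mleCov X z.1), Θ) ∂(matVolume ι q) +
    w * matNormalPDF z.2 (X * mleCoef X z.1) (mleCov X z.1),
    ((hsm.comp hpair).const_mul _).add ((hpdf.comp hcoef).const_mul _), fun z hz => ?_⟩
  rw [predictive, mixtureMarginal, hsm' _ hz]

end

section

variable {m ι q : Type*} [Fintype m] [Fintype ι] [Fintype q] [DecidableEq m] [DecidableEq ι]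
  [DecidableEq q]

/-! ### Reduction to standard normal errors -/

/-- The map from two standard normal matrices to the data and their independent copy. -/
def regressionPair (M : Matrix m q ℝ) (R : Matrix q q ℝ) (z : Matrix m q ℝ × Matrix m q ℝ) :
    Matrix m q ℝ × Matrix m q ℝ :=
  (M + z.1 * R, M + z.2 * R)

theorem continuous_regressionPair (M : Matrix m q ℝ) (R : Matrix q q ℝ) :
    Continuous (regressionPair M R) := by
  unfold regressionPair
  fun_prop

theorem measurableEmbedding_regressionPair (M : Matrix m q ℝ) {R : Matrix q q ℝ}
    (hR : R.PosDef) : MeasurableEmbedding (regressionPair M R) := by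
  refine (continuous_regressionPair M R).measurableEmbedding fun z z' h => ?_
  have hinj : ∀ E E' : Matrix m q ℝ, M + E * R = M + E' * R → E = E' := fun E E' h => by
    have h' := congrArg (· * R⁻¹) (add_left_cancel h)
    have hu : IsUnit R.det := hR.det_pos.ne'.isUnit
    simpa [Matrix.mul_assoc, Matrix.mul_nonsing_inv _ hu] using h'
  exact Prod.ext (hinj _ _ (congrArg Prod.fst h)) (hinj _ _ (congrArg Prod.snd h))

theorem map_stdPair_regressionPair (M : Matrix m q ℝ) {R S : Matrix q q ℝ} (hR : R.PosDef)
    (hRS : R * R = S) : (stdPair m q).map (regressionPair M R) = pairLaw M S := by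
  have hmeas : Measurable fun E : Matrix m q ℝ => M + E * R :=
    Continuous.measurable (by fun_prop)
  rw [pairLaw, ← map_stdNormal_affine M hR hRS, Measure.map_prod_map _ _ hmeas hmeas]
  rfl

theorem mleCov_affine {X : Matrix m ι ℝ} (hX : (Xᵀ * X).det ≠ 0) (Θ : Matrix ι q ℝ)
    {R : Matrix q q ℝ} (hR : R.PosDef) (E : Matrix m q ℝ) :
    mleCov X (X * Θ + E * R) = (Fintype.card m : ℝ)⁻¹ • (R * residGram X E * R) := by
  have hRt : Rᵀ = R := by simpa using hR.isHermitian.eq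
  have h : (1 - projMat X) * (X * Θ + E * R) = (1 - projMat X) * E * R := by
    rw [Matrix.mul_add, ← Matrix.mul_assoc, Matrix.sub_mul, projMat_mul_self_design hX,
      Matrix.one_mul, sub_self, Matrix.zero_mul, zero_add, Matrix.mul_assoc]
  rw [mleCov_eq, residGram_eq hX, h, residGram_eq hX, Matrix.transpose_mul, hRt]
  simp only [Matrix.mul_assoc]

theorem posDef_mleCov_affine [Nonempty m] {X : Matrix m ι ℝ} (hX : (Xᵀ * X).det ≠ 0)
    (Θ : Matrix ι q ℝ) {R : Matrix q q ℝ} (hR : R.PosDef) {E : Matrix m q ℝ}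
    (hE : (residGram X E).PosDef) : (mleCov X (X * Θ + E * R)).PosDef := by
  rw [mleCov_affine hX Θ hR]
  refine Matrix.PosDef.smul ?_ (by positivity)
  have h := hE.conjTranspose_mul_mul_same
    (Matrix.mulVec_injective_of_isUnit (hR.isUnit))
  rwa [hR.isHermitian.eq] at h

theorem trace_inv_mleCov_affine [Nonempty m] {X : Matrix m ι ℝ} (hX : (Xᵀ * X).det ≠ 0)
    (Θ : Matrix ι q ℝ) {R : Matrix q q ℝ} (hR : R.PosDef) {E : Matrix m q ℝ}
    (hE : (residGram X E).PosDef) (B : Matrix q q ℝ) :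
    ((mleCov X (X * Θ + E * R))⁻¹ * (R * B * R)).trace =
      Fintype.card m * ((residGram X E)⁻¹ * B).trace := by
  have hu : IsUnit R.det := hR.det_pos.ne'.isUnit
  have hinv : (mleCov X (X * Θ + E * R))⁻¹ =
      (Fintype.card m : ℝ) • (R⁻¹ * ((residGram X E)⁻¹ * R⁻¹)) := by
    refine Matrix.inv_eq_right_inv ?_
    have hn : (Fintype.card m : ℝ) ≠ 0 := by positivity
    rw [mleCov_affine hX Θ hR, Matrix.smul_mul, Matrix.mul_smul, smul_smul, inv_mul_cancel₀ hn,
      one_smul, Matrix.mul_assoc, ← Matrix.mul_assoc R R⁻¹, Matrix.mul_nonsing_inv _ hu,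
      Matrix.one_mul, Matrix.mul_assoc, ← Matrix.mul_assoc (residGram X E),
      Matrix.mul_nonsing_inv _ hE.det_pos.ne'.isUnit, Matrix.one_mul, Matrix.mul_nonsing_inv _ hu]
  have h : R⁻¹ * ((residGram X E)⁻¹ * R⁻¹) * (R * B * R) =
      R⁻¹ * ((residGram X E)⁻¹ * B) * R := by
    simp only [Matrix.mul_assoc]
    rw [← Matrix.mul_assoc R⁻¹ R (B * R), Matrix.nonsing_inv_mul _ hu, Matrix.one_mul]
  rw [hinv, Matrix.smul_mul, Matrix.trace_smul, h, Matrix.trace_mul_comm, ← Matrix.mul_assoc,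
    Matrix.mul_nonsing_inv _ hu, Matrix.one_mul, smul_eq_mul]

theorem lossGap_regressionPair [Nonempty m] {π : Matrix ι q ℝ → Matrix q q ℝ → ℝ}
    (hπ : IsPriorDensity π) {X : Matrix m ι ℝ} (hX : (Xᵀ * X).det ≠ 0) {w : ℝ} (hw : 0 < w)
    (hw1 : w < 1) (Θ : Matrix ι q ℝ) {R : Matrix q q ℝ} (hR : R.PosDef)
    {z : Matrix m q ℝ × Matrix m q ℝ} (hz : (residGram X z.1).PosDef) :
    lossGap π X w (regressionPair (X * Θ) R z) =
      Fintype.card m * (wForm X 1 z - 2 * crossForm X z + fitForm X z) -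
      Fintype.card m * Fintype.card q +
      (2 * Real.log (1 + priorRatio π X w (X * Θ + z.1 * R) (X * Θ + z.1 * R)) -
        2 * Real.log (1 + priorRatio π X w (X * Θ + z.1 * R) (X * Θ + z.2 * R))) := by
  obtain ⟨E, F⟩ := z
  have hP := projMat_mul_projMat hX
  have hP' := transpose_projMat X
  have hRt : Rᵀ = R := by simpa using hR.isHermitian.eq
  have hpos := posDef_mleCov_affine hX Θ hR hz
  have hres : ∀ G : Matrix m q ℝ, X * Θ + G * R - X * mleCoef X (X * Θ + E * R) =
      (G - projMat X * E) * R := by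
    intro G
    rw [mul_mleCoef, Matrix.mul_add, ← Matrix.mul_assoc, projMat_mul_self_design hX,
      Matrix.sub_mul, Matrix.mul_assoc (projMat X)]
    abel
  have hsq : ∀ G : Matrix m q ℝ, ((G - projMat X * E) * R)ᵀ * ((G - projMat X * E) * R) =
      R * ((G - projMat X * E)ᵀ * (G - projMat X * E)) * R := by
    intro G
    rw [Matrix.transpose_mul, hRt]
    simp only [Matrix.mul_assoc]
  have hself : (E - projMat X * E)ᵀ * (E - projMat X * E) = residGram X E := by
    rw [residGram_eq hX, Matrix.sub_mul, Matrix.one_mul]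
  have hquad : ((residGram X E)⁻¹ * ((F - projMat X * E)ᵀ * (F - projMat X * E))).trace =
      wForm X 1 (E, F) - 2 * crossForm X (E, F) + fitForm X (E, F) := by
    have ht : ((residGram X E)⁻¹)ᵀ = (residGram X E)⁻¹ := by
      simpa using hz.inv.isHermitian.eq
    have h := trace_quadratic_sub ht (K := (1 : Matrix m m ℝ)) (by simp) (projMat X * E) F
    have h2 : (projMat X * E)ᵀ * (1 : Matrix m m ℝ) * (projMat X * E) = Eᵀ * projMat X * E := by
      rw [Matrix.transpose_mul, hP', Matrix.mul_one, Matrix.mul_assoc, ← Matrix.mul_assoc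
        (projMat X), hP, Matrix.mul_assoc]
    rw [h2] at h
    simp only [Matrix.mul_one, ← Matrix.mul_assoc] at h
    simp only [wForm, crossForm, fitForm, Matrix.mul_one, ← Matrix.mul_assoc]
    exact h
  rw [regressionPair, lossGap_eq hπ X hw hw1 hpos, hres, hres, hsq, hsq, hself,
    trace_inv_mleCov_affine hX Θ hR hz, trace_inv_mleCov_affine hX Θ hR hz, hquad,
    Matrix.nonsing_inv_mul _ hz.det_pos.ne'.isUnit, Matrix.trace_one]

/-- If the effect of the smooth part of the prior is dominated by `g`, then the bias differs from
that of the plug-in Gaussian density by at most the mean of `g`. -/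
theorem abs_bias_sub_le {π : Matrix ι q ℝ → Matrix q q ℝ → ℝ}
    (hπ : IsPriorDensity π) (hscale : IsScaleFamily π) {X : Matrix m ι ℝ}
    (hX : (Xᵀ * X).det ≠ 0) (hm : Fintype.card ι + Fintype.card q + 4 ≤ Fintype.card m)
    {w : ℝ} (hw : 0 < w) (hw1 : w < 1) (Θ : Matrix ι q ℝ) {R S : Matrix q q ℝ} (hR : R.PosDef)
    (hRS : R * R = S) {g : Matrix m q ℝ × Matrix m q ℝ → ℝ} (hg : Integrable g (stdPair m q))
    (hle : ∀ z : Matrix m q ℝ × Matrix m q ℝ, (residGram X z.1).PosDef →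
      |2 * Real.log (1 + priorRatio π X w (X * Θ + z.1 * R) (X * Θ + z.1 * R)) -
        2 * Real.log (1 + priorRatio π X w (X * Θ + z.1 * R) (X * Θ + z.2 * R))| ≤ g z) :
    Integrable (lossGap π X w) (pairLaw (X * Θ) S) ∧
      |bias π X w (X * Θ) S - (Fintype.card m : ℝ) * Fintype.card q *
        (2 * Fintype.card ι + Fintype.card q + 1) /
          ((Fintype.card m : ℝ) - Fintype.card q - Fintype.card ι - 1)| ≤
        ∫ z, g z ∂(stdPair m q) := by
  have : Nonempty m := Fintype.card_pos_iff.mp (by omega)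
  have hae : ∀ᵐ z ∂(stdPair m q), (residGram X z.1).PosDef :=
    ae_stdPair_of_ae_fst (ae_posDef_residGram (q := q) hX (by omega))
  obtain ⟨h1, h2⟩ := integral_lossForm (q := q) hX hm
  set L : Matrix m q ℝ × Matrix m q ℝ → ℝ := fun z =>
    Fintype.card m * (wForm X 1 z - 2 * crossForm X z + fitForm X z) -
      Fintype.card m * Fintype.card q with hL
  have hLint : Integrable L (stdPair m q) := (h1.const_mul _).sub (integrable_const _)
  have hLval : ∫ z, L z ∂(stdPair m q) = (Fintype.card m : ℝ) * Fintype.card q *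
        (2 * Fintype.card ι + Fintype.card q + 1) /
          ((Fintype.card m : ℝ) - Fintype.card q - Fintype.card ι - 1) := by
    rw [hL, integral_sub (h1.const_mul _) (integrable_const _), integral_const_mul, h2,
      integral_const, probReal_univ, one_smul]
    have hδ : (Fintype.card m : ℝ) - Fintype.card q - Fintype.card ι - 1 ≠ 0 := by
      have : (Fintype.card ι : ℝ) + Fintype.card q + 4 ≤ Fintype.card m := by exact_mod_cast hm
      linarith
    field_simp
    ring
  set φ := regressionPair (X * Θ) R with hφ
  have hφm : Measurable φ := (continuous_regressionPair _ _).measurable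
  obtain ⟨G, hG, hG'⟩ := exists_measurable_predictive hπ hscale X w (m := m)
  have hmeas : AEStronglyMeasurable (fun z => lossGap π X w (φ z)) (stdPair m q) := by
    have hself : Measurable fun z => ((φ z).1, (φ z).1) :=
      (measurable_fst.comp hφm).prodMk (measurable_fst.comp hφm)
    refine ((((hG.comp hφm).log.const_mul (-2)).add
      ((hG.comp hself).log.const_mul 2)).aestronglyMeasurable).congr ?_
    filter_upwards [hae] with z hz
    have hpos := posDef_mleCov_affine hX Θ hR hz
    simp only [lossGap, Pi.add_apply, Function.comp]
    rw [hG' (φ z) hpos, hG' ((φ z).1, (φ z).1) hpos]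
  have hdiff : ∀ᵐ z ∂(stdPair m q), ‖lossGap π X w (φ z) - L z‖ ≤ g z := by
    filter_upwards [hae] with z hz
    rw [hφ, lossGap_regressionPair hπ hX hw hw1 Θ hR hz, hL, add_sub_cancel_left]
    exact hle z hz
  have hdint : Integrable (fun z => lossGap π X w (φ z) - L z) (stdPair m q) :=
    hg.mono' (hmeas.sub hLint.aestronglyMeasurable) hdiff
  have hint : Integrable (fun z => lossGap π X w (φ z)) (stdPair m q) := by
    refine (hdint.add hLint).congr (ae_of_all _ fun z => ?_)
    simp
  have hemb : MeasurableEmbedding φ := measurableEmbedding_regressionPair _ hR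
  rw [bias, ← map_stdPair_regressionPair (X * Θ) hR hRS, hemb.integrable_map_iff,
    hemb.integral_map, ← hLval, ← integral_sub hint hLint]
  exact ⟨hint, norm_integral_le_of_norm_le hg hdiff⟩

theorem bias_eq_of_isEmpty [IsEmpty ι] {π : Matrix ι q ℝ → Matrix q q ℝ → ℝ}
    (hπ : IsPriorDensity π) (hscale : IsScaleFamily π) {X : Matrix m ι ℝ}
    (hm : Fintype.card ι + Fintype.card q + 4 ≤ Fintype.card m)
    {w : ℝ} (hw : 0 < w) (hw1 : w < 1) (Θ : Matrix ι q ℝ) {S : Matrix q q ℝ} (hS : S.PosDef) :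
    Integrable (lossGap π X w) (pairLaw (X * Θ) S) ∧
      bias π X w (X * Θ) S = (Fintype.card m : ℝ) * Fintype.card q *
        (2 * Fintype.card ι + Fintype.card q + 1) /
          ((Fintype.card m : ℝ) - Fintype.card q - Fintype.card ι - 1) := by
  obtain ⟨R, hR, hRS⟩ := exists_posDef_mul_self_eq hS
  have hX : (Xᵀ * X).det ≠ 0 := by simp
  have : Nonempty m := Fintype.card_pos_iff.mp (by omega)
  obtain ⟨h1, h2⟩ := abs_bias_sub_le hπ hscale hX hm hw hw1 Θ hR hRS (g := fun _ => 0)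
    (integrable_zero _ _ _) fun z hz => by
      have hpos := posDef_mleCov_affine hX Θ hR hz
      rw [priorRatio_eq_of_isEmpty X w hpos, priorRatio_eq_of_isEmpty X w hpos, sub_self, abs_zero]
  rw [integral_zero] at h2
  exact ⟨h1, sub_eq_zero.mp (abs_nonpos_iff.mp h2)⟩

/-- The bias is that of the plug-in Gaussian density up to a remainder that is small as soon as the
smooth part of the prior is at most `exp (-b)` relative to the atom. -/
theorem abs_bias_sub_le_of_le_exp {π : Matrix ι q ℝ → Matrix q q ℝ → ℝ}
    (hπ : IsPriorDensity π) (hscale : IsScaleFamily π) {c : ℝ} (hc : ∀ Θ, π Θ 1 ≤ c)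
    {X : Matrix m ι ℝ} (hX : (Xᵀ * X).det ≠ 0)
    (hm : Fintype.card ι + Fintype.card q + 4 ≤ Fintype.card m)
    {w : ℝ} (hw : 0 < w) (hw1 : w < 1) (Θ : Matrix ι q ℝ) {S : Matrix q q ℝ} (hS : S.PosDef)
    {b : ℝ} (hb : 0 < b)
    (ha : (1 - w) / w * ((2 * Real.pi) ^ ((Fintype.card ι : ℝ) * Fintype.card q / 2) *
        (Xᵀ * X).det ^ (-((Fintype.card q : ℝ) / 2)) * c) ≤ Real.exp (-b)) :
    Integrable (lossGap π X w) (pairLaw (X * Θ) S) ∧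
      |bias π X w (X * Θ) S - (Fintype.card m : ℝ) * Fintype.card q *
        (2 * Fintype.card ι + Fintype.card q + 1) /
          ((Fintype.card m : ℝ) - Fintype.card q - Fintype.card ι - 1)| ≤
        2 * Real.exp (-(b / 2)) + 2 * (1 / b ^ 2 + 1 / (2 * b)) * (Fintype.card m : ℝ) ^ 2 *
          (16 * (gaussFour * (Fintype.card ι : ℝ) ^ 2 * ((Fintype.card q : ℝ) ^ 2 /
          (((Fintype.card m : ℝ) - Fintype.card q - Fintype.card ι - 1) *
            ((Fintype.card m : ℝ) - Fintype.card q - Fintype.card ι - 3))))) := by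
  obtain ⟨R, hR, hRS⟩ := exists_posDef_mul_self_eq hS
  have hRt : Rᵀ = R := by simpa using hR.isHermitian.eq
  have : Nonempty m := Fintype.card_pos_iff.mp (by omega)
  obtain ⟨h1, h2⟩ := integral_sq_gapForm (q := q) hX hm
  have hgint := (integrable_const (2 * Real.exp (-(b / 2)))).add
    (h1.const_mul (2 * (1 / b ^ 2 + 1 / (2 * b)) * (Fintype.card m : ℝ) ^ 2))
  obtain ⟨h3, h4⟩ := abs_bias_sub_le hπ hscale hX hm hw hw1 Θ hR hRS hgint fun z hz => by
    have hpos := posDef_mleCov_affine hX Θ hR hz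
    have hgap0 : 0 ≤ gapForm X z := trace_quadratic_nonneg hz.inv.posSemidef
      (projMat_mul_projMat hX) (transpose_projMat X) _
    have hlog : ∀ Z : Matrix m q ℝ, 0 ≤ Real.log (1 + priorRatio π X w (X * Θ + z.1 * R) Z) :=
      fun Z => Real.log_nonneg (by linarith [priorRatio_nonneg hπ X hw hw1 hpos Z])
    have hself : Real.log (1 + priorRatio π X w (X * Θ + z.1 * R) (X * Θ + z.1 * R)) ≤
        Real.exp (-(b / 2)) := by
      have h := priorRatio_le hπ hscale hc hX hw hw1 hpos (X * Θ + z.1 * R)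
      rw [sub_self, Matrix.transpose_zero, Matrix.zero_mul, Matrix.zero_mul, Matrix.mul_zero,
        Matrix.trace_zero] at h
      have h' := log_one_add_le_of_le_mul_exp (priorRatio_nonneg hπ X hw hw1 hpos _) hb le_rfl ha h
      simpa using h'
    have hother : Real.log (1 + priorRatio π X w (X * Θ + z.1 * R) (X * Θ + z.2 * R)) ≤
        Real.exp (-(b / 2)) + (1 / b ^ 2 + 1 / (2 * b)) *
          (Fintype.card m * gapForm X z) ^ 2 := by
      have h := priorRatio_le hπ hscale hc hX hw hw1 hpos (X * Θ + z.2 * R)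
      have hQ : (X * Θ + z.2 * R - (X * Θ + z.1 * R))ᵀ * projMat X *
          (X * Θ + z.2 * R - (X * Θ + z.1 * R)) =
          R * ((z.2 - z.1)ᵀ * projMat X * (z.2 - z.1)) * R := by
        rw [add_sub_add_left_eq_sub, ← Matrix.sub_mul, Matrix.transpose_mul, hRt]
        simp only [Matrix.mul_assoc]
      rw [hQ, trace_inv_mleCov_affine hX Θ hR hz] at h
      exact log_one_add_le_of_le_mul_exp (priorRatio_nonneg hπ X hw hw1 hpos _) hb
        (by positivity) ha h
    have h5 : 0 ≤ (1 / b ^ 2 + 1 / (2 * b)) * (Fintype.card m * gapForm X z) ^ 2 := by positivity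
    simp only [Pi.add_apply]
    rw [abs_le]
    have := hlog (X * Θ + z.1 * R)
    have := hlog (X * Θ + z.2 * R)
    constructor <;> linarith
  refine ⟨h3, h4.trans ?_⟩
  simp only [Pi.add_apply]
  rw [integral_add (integrable_const _) (h1.const_mul _), integral_const, probReal_univ, one_smul,
    integral_const_mul]
  gcongr

end

section

/-! ### Asymptotics -/

/-- A submodel's mean is a mean of the larger model. -/
theorem exists_cols_mul_eq {m κ q : Type*} [DecidableEq κ] (X : Matrix m κ ℝ) {s t : Finset κ}
    (h : s ⊆ t) (Θ : Matrix s q ℝ) : ∃ Θ' : Matrix t q ℝ, cols X s * Θ = cols X t * Θ' := by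
  refine ⟨Matrix.of fun l a => if hl : l.1 ∈ s then Θ ⟨l.1, hl⟩ a else 0, ?_⟩
  ext i a
  let f : κ → ℝ := fun l => X i l * if hl : l ∈ s then Θ ⟨l, hl⟩ a else 0
  have h1 : (cols X s * Θ) i a = ∑ l ∈ s, f l := by
    rw [← Finset.sum_coe_sort s f, Matrix.mul_apply]
    refine Finset.sum_congr rfl fun l _ => ?_
    simp [f, cols]
  rw [h1, Finset.sum_subset h fun l _ hl => by simp [f, hl], ← Finset.sum_coe_sort t f,
    Matrix.mul_apply]
  rfl

/-- Since `p / n` stays away from `1`, the degrees of freedom are of order `n`. -/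
theorem eventually_dimension {p : ℕ → ℕ} {c₀ : ℝ} (hc₁ : c₀ < 1)
    (hpn : Tendsto (fun n : ℕ => (p n : ℝ) / (n : ℝ)) atTop (𝓝 c₀)) (r : ℕ) :
    ∃ B : ℝ, 0 ≤ B ∧ ∀ᶠ n : ℕ in atTop, r + p n + 4 ≤ n ∧
      (n : ℝ) ^ 2 / (((n : ℝ) - p n - r - 1) * ((n : ℝ) - p n - r - 3)) ≤ B := by
  -- `(n - p - r - 3) / n` tends to `1 - c₀ > d`
  have hd : 0 < (1 - c₀) / 2 := by linarith
  set d := (1 - c₀) / 2 with hd'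
  have hr : Tendsto (fun n : ℕ => ((r : ℝ) + 3) / (n : ℝ)) atTop (𝓝 0) :=
    tendsto_const_div_atTop_nhds_zero_nat _
  have hlim := (hpn.const_sub 1).sub hr
  have hev := hlim.eventually_const_le (show d < 1 - c₀ - 0 by linarith)
  refine ⟨1 / d ^ 2, by positivity, ?_⟩
  filter_upwards [hev, eventually_gt_atTop 0] with n hn hn0
  have hn' : (0 : ℝ) < n := by exact_mod_cast hn0
  have h1 : d * n ≤ (n : ℝ) - p n - r - 3 := by
    have := mul_le_mul_of_nonneg_right hn hn'.le
    have h2 : (1 - (p n : ℝ) / n - ((r : ℝ) + 3) / n) * n = (n : ℝ) - p n - r - 3 := by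
      field_simp
      ring
    linarith
  have hdn : 0 < d * n := by positivity
  refine ⟨?_, ?_⟩
  · have h2 : ((r + p n + 3 : ℕ) : ℝ) < n := by
      push_cast
      linarith
    have := Nat.cast_lt.mp h2
    omega
  · rw [div_le_div_iff₀ (mul_pos (by linarith) (by linarith)) (by positivity), one_mul]
    have := mul_le_mul h1 (show d * n ≤ (n : ℝ) - p n - r - 1 by linarith) hdn.le (by linarith)
    nlinarith

/-- The size of the smooth part of the prior relative to the atom decays exponentially in the
number `q` of responses. -/
theorem relative_weight_le {n q r : ℕ} (hn : 0 < n) (hq : 0 < q) {w ℓ δ D c C : ℝ} (hw : 0 < w)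
    (hw1 : w < 1) (hℓ : 0 < ℓ) (hδ : 0 < δ) (hD : δ < (n : ℝ)⁻¹ ^ r * D) (hc : 0 ≤ c)
    (hC : (1 - w) * ℓ ^ ((q : ℝ) * r / 2) / (w * (n : ℝ) ^ ((q : ℝ) * r / 2)) * c ≤ C) :
    (1 - w) / w * ((2 * Real.pi) ^ ((r : ℝ) * q / 2) * D ^ (-((q : ℝ) / 2)) * c) ≤
      (max C 1 * (2 * Real.pi) ^ ((r : ℝ) / 2) * δ ^ (-(1 / 2) : ℝ) * ℓ ^ (-((r : ℝ) / 2))) ^ q := by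
  have hn' : (0 : ℝ) < n := by exact_mod_cast hn
  have hpi : (0 : ℝ) < 2 * Real.pi := by positivity
  set s : ℝ := (q : ℝ) * r / 2 with hs
  have hDn : δ * (n : ℝ) ^ r ≤ D := by
    rw [inv_pow, ← div_eq_inv_mul, lt_div_iff₀ (by positivity)] at hD
    exact hD.le
  have hDpow : D ^ (-((q : ℝ) / 2)) ≤ δ ^ (-((q : ℝ) / 2)) * (n : ℝ) ^ (-s) := by
    refine (Real.rpow_le_rpow_of_nonpos (by positivity) hDn
      (neg_nonpos.mpr (by positivity))).trans_eq ?_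
    rw [Real.mul_rpow hδ.le (by positivity), ← Real.rpow_natCast_mul hn'.le]
    congr 2
    rw [hs]
    ring
  have hsplit : (1 - w) / w * c =
      (1 - w) * ℓ ^ s / (w * (n : ℝ) ^ s) * c * (ℓ ^ (-s) * (n : ℝ) ^ s) := by
    rw [Real.rpow_neg hℓ.le]
    have := Real.rpow_pos_of_pos hℓ s
    have := Real.rpow_pos_of_pos hn' s
    field_simp
  -- a constant factor is absorbed into the exponential rate
  have hmax : C ≤ max C 1 ^ q :=
    (le_max_left C 1).trans (le_self_pow₀ (le_max_right C 1) hq.ne')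
  have hwc : 0 ≤ (1 - w) / w * c := mul_nonneg (div_nonneg (by linarith) hw.le) hc
  have hwc' : (1 - w) / w * c ≤ max C 1 ^ q * (ℓ ^ (-s) * (n : ℝ) ^ s) := by
    rw [hsplit]
    exact mul_le_mul_of_nonneg_right (hC.trans hmax) (by positivity)
  have hpow : ∀ {x : ℝ} (y : ℝ), 0 ≤ x → (x ^ y) ^ q = x ^ (y * q) := fun y hx => by
    rw [Real.rpow_mul_natCast hx]
  calc (1 - w) / w * ((2 * Real.pi) ^ ((r : ℝ) * q / 2) * D ^ (-((q : ℝ) / 2)) * c)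
      = ((1 - w) / w * c) * (2 * Real.pi) ^ s * D ^ (-((q : ℝ) / 2)) := by
        rw [hs, mul_comm (r : ℝ)]
        ring
    _ ≤ (max C 1 ^ q * (ℓ ^ (-s) * (n : ℝ) ^ s)) * (2 * Real.pi) ^ s *
        (δ ^ (-((q : ℝ) / 2)) * (n : ℝ) ^ (-s)) := by
        have hD0 : 0 ≤ D := le_trans (by positivity) hDn
        gcongr
    _ = _ := by
        rw [mul_pow, mul_pow, mul_pow, hpow _ hpi.le, hpow _ hδ.le, hpow _ hℓ.le]
        have e1 : (r : ℝ) / 2 * q = s := by rw [hs]; ring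
        have e2 : -((r : ℝ) / 2) * q = -s := by rw [hs]; ring
        have e3 : (-(1 / 2) : ℝ) * q = -((q : ℝ) / 2) := by ring
        have e4 : (n : ℝ) ^ s * (n : ℝ) ^ (-s) = 1 := by
          rw [← Real.rpow_add hn', add_neg_cancel, Real.rpow_zero]
        rw [e1, e2, e3]
        linear_combination (max C 1 ^ q * ℓ ^ (-s) * (2 * Real.pi) ^ s * δ ^ (-((q : ℝ) / 2))) * e4

/-- The remainder is `p` times a quantity that vanishes as the decay rate `L` grows. -/
theorem remainder_le {L N B d q G : ℝ} (hL : 0 < L) (hq : 1 ≤ q) (hG : 0 ≤ G)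
    (hB0 : 0 ≤ B) (hB : N ^ 2 / d ≤ B) :
    2 * Real.exp (-(q * L / 2)) + 2 * (1 / (q * L) ^ 2 + 1 / (2 * (q * L))) * N ^ 2 *
      (16 * (G * (q ^ 2 / d))) ≤
    q * (2 * Real.exp (-(L / 2)) + 32 * G * B * (1 / L ^ 2 + 1 / (2 * L))) := by
  have h1 : Real.exp (-(q * L / 2)) ≤ q * Real.exp (-(L / 2)) := by
    have h : Real.exp (-(q * L / 2)) ≤ Real.exp (-(L / 2)) :=
      Real.exp_le_exp.mpr (by nlinarith)
    nlinarith [Real.exp_pos (-(L / 2))]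
  have hq0 : q ≠ 0 := by positivity
  have h2 : 2 * (1 / (q * L) ^ 2 + 1 / (2 * (q * L))) * N ^ 2 * (16 * (G * (q ^ 2 / d))) =
      32 * G * (N ^ 2 / d) * (1 / L ^ 2 + q * (1 / (2 * L))) := by
    field_simp
    ring
  have h3 : 0 ≤ 32 * G * (1 / L ^ 2 + q * (1 / (2 * L))) := by positivity
  have h4 : 32 * G * (N ^ 2 / d) * (1 / L ^ 2 + q * (1 / (2 * L))) ≤
      q * (32 * G * B * (1 / L ^ 2 + 1 / (2 * L))) := by
    calc 32 * G * (N ^ 2 / d) * (1 / L ^ 2 + q * (1 / (2 * L)))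
        ≤ 32 * G * B * (q * (1 / L ^ 2) + q * (1 / (2 * L))) := by
          have h5 : 1 / L ^ 2 ≤ q * (1 / L ^ 2) := le_mul_of_one_le_left (by positivity) hq
          gcongr
      _ = _ := by ring
  rw [h2]
  linarith

theorem tendsto_remainder {L : ℕ → ℝ} (hL : Tendsto L atTop atTop) (K : ℝ) :
    Tendsto (fun n => 2 * Real.exp (-(L n / 2)) + K * (1 / L n ^ 2 + 1 / (2 * L n))) atTop
      (𝓝 0) := by
  have h1 : Tendsto (fun n => Real.exp (-(L n / 2))) atTop (𝓝 0) :=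
    Real.tendsto_exp_neg_atTop_nhds_zero.comp (hL.atTop_div_const two_pos)
  have h2 : Tendsto (fun n => 1 / L n ^ 2) atTop (𝓝 0) :=
    tendsto_const_nhds.div_atTop ((tendsto_pow_atTop two_ne_zero).comp hL)
  have h3 : Tendsto (fun n => 1 / (2 * L n)) atTop (𝓝 0) :=
    tendsto_const_nhds.div_atTop (hL.const_mul_atTop two_pos)
  simpa using (h1.const_mul 2).add ((h2.add h3).const_mul K)

/-- The weight condition in real numbers: where `ℓ n > 0` it makes the supremum of the prior finite. -/
theorem exists_bound_of_weightCondition {ι : Type*} [Fintype ι] {p : ℕ → ℕ} {w : ℕ → ℝ}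
    (hw : ∀ n, 0 < w n ∧ w n < 1)
    {π : (n : ℕ) → Matrix ι (Fin (p n)) ℝ → Matrix (Fin (p n)) (Fin (p n)) ℝ → ℝ}
    (h : WeightCondition p w π) :
    ∃ (ℓ : ℕ → ℝ) (C : ℝ), Tendsto ℓ atTop atTop ∧ ∀ n : ℕ, 0 < n → 0 < ℓ n →
      ∃ c, 0 ≤ c ∧ (∀ Θ, π n Θ 1 ≤ c) ∧
        (1 - w n) * ℓ n ^ ((p n : ℝ) * Fintype.card ι / 2) /
          (w n * (n : ℝ) ^ ((p n : ℝ) * Fintype.card ι / 2)) * c ≤ C := by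
  obtain ⟨ℓ, -, hℓ, hsup⟩ := h
  set u : ℕ → ENNReal := fun n => ENNReal.ofReal
    ((1 - w n) * ℓ n ^ ((p n : ℝ) * (Fintype.card ι : ℝ) / 2)
      / (w n * (n : ℝ) ^ ((p n : ℝ) * (Fintype.card ι : ℝ) / 2))) * priorSup (π n) with hu
  refine ⟨ℓ, (⨆ n, u n).toReal, hℓ, fun n hn hℓn => ?_⟩
  obtain ⟨hw0, hw1⟩ := hw n
  have hn' : (0 : ℝ) < n := by exact_mod_cast hn
  have hcoef : 0 < (1 - w n) * ℓ n ^ ((p n : ℝ) * Fintype.card ι / 2) /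
      (w n * (n : ℝ) ^ ((p n : ℝ) * Fintype.card ι / 2)) := by
    have : 0 < 1 - w n := by linarith
    positivity
  have hle : u n ≤ ⨆ n, u n := le_iSup u n
  simp only [hu] at hle
  have hfin : priorSup (π n) ≠ ⊤ := by
    intro htop
    rw [htop, ENNReal.mul_top (ENNReal.ofReal_pos.mpr hcoef).ne'] at hle
    exact (hsup.trans_le hle).ne rfl
  refine ⟨(priorSup (π n)).toReal, ENNReal.toReal_nonneg, fun Θ => ?_, ?_⟩
  · exact (ENNReal.ofReal_le_iff_le_toReal hfin).mp
      (le_iSup (fun Θ => ENNReal.ofReal (π n Θ 1)) Θ)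
  · have := ENNReal.toReal_mono hsup.ne hle
    rwa [ENNReal.toReal_mul, ENNReal.toReal_ofReal hcoef.le] at this

/-- The decay rate of the smooth part of the prior relative to the atom. -/
theorem tendsto_neg_log_rate {ℓ : ℕ → ℝ} (hℓ : Tendsto ℓ atTop atTop) {r : ℕ} (hr : 0 < r)
    (A : ℝ) (hA : 0 < A) :
    Tendsto (fun n => -Real.log (A * ℓ n ^ (-((r : ℝ) / 2)))) atTop atTop := by
  have h1 : Tendsto (fun n => A * ℓ n ^ (-((r : ℝ) / 2))) atTop (𝓝[>] 0) := by
    refine tendsto_nhdsWithin_iff.mpr ⟨?_, ?_⟩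
    · simpa using ((tendsto_rpow_neg_atTop (y := (r : ℝ) / 2) (by positivity)).comp hℓ).const_mul A
    · filter_upwards [hℓ.eventually_gt_atTop 0] with n hn
      exact mul_pos hA (Real.rpow_pos_of_pos hn _)
  exact tendsto_neg_atBot_atTop.comp (Real.tendsto_log_nhdsGT_zero.comp h1)

end

end MPIC

end

theorem mainTheorem3
    -- dimensions: `n` observations, `p n` responses, `k` explanatory variables
    (k : ℕ) (p : ℕ → ℕ) (hp : ∀ n, 0 < p n)
    (c₀ : ℝ) (hc₀ : 0 ≤ c₀) (hc₁ : c₀ < 1)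
    (hpn : Tendsto (fun n : ℕ => (p n : ℝ) / (n : ℝ)) atTop (𝓝 c₀))
    -- the design matrices, of full column rank
    (X : (n : ℕ) → Matrix (Fin n) (Fin k) ℝ) (hX : ∀ n, k < n → (X n).rank = k)
    -- the true model, and a candidate model that contains it
    (jt j : Finset (Fin k)) (hj : jt ⊆ j)
    (Θt : (n : ℕ) → Matrix jt (Fin (p n)) ℝ)
    (St : (n : ℕ) → Matrix (Fin (p n)) (Fin (p n)) ℝ) (hSt : ∀ n, (St n).PosDef)
    -- the mixture prior
    (w : ℕ → ℝ) (hw : ∀ n, 0 < w n ∧ w n < 1)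
    (π : (n : ℕ) → Matrix j (Fin (p n)) ℝ → Matrix (Fin (p n)) (Fin (p n)) ℝ → ℝ)
    (hπ : ∀ n, MPIC.IsPriorDensity (π n))
    (hscale : ∀ n, MPIC.IsScaleFamily (π n))
    (hweight : MPIC.WeightCondition p w π)
    (hdet : (0 : EReal) < liminf (fun n : ℕ =>
      ((((n : ℝ)⁻¹ • ((MPIC.cols (X n) j)ᵀ * MPIC.cols (X n) j)).det : ℝ) : EReal)) atTop) :
    (∀ᶠ n : ℕ in atTop, Integrable (MPIC.lossGap (π n) (MPIC.cols (X n) j) (w n))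
      (MPIC.pairLaw (MPIC.cols (X n) jt * Θt n) (St n))) ∧
    (fun n : ℕ =>
      MPIC.bias (π n) (MPIC.cols (X n) j) (w n) (MPIC.cols (X n) jt * Θt n) (St n)
        - (n : ℝ) * (p n : ℝ) * (2 * (j.card : ℝ) + (p n : ℝ) + 1)
          / ((n : ℝ) - (p n : ℝ) - (j.card : ℝ) - 1))
      =o[atTop] fun n : ℕ => (p n : ℝ) := by
  choose Θ hΘ using fun n => MPIC.exists_cols_mul_eq (X n) hj (Θt n)
  simp only [hΘ]
  obtain ⟨B, hB0, hdim⟩ := MPIC.eventually_dimension hc₁ hpn j.card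
  -- it suffices to bound the remainder by `p` times a vanishing sequence
  suffices h : ∃ ε : ℕ → ℝ, Tendsto ε atTop (𝓝 0) ∧ ∀ᶠ n : ℕ in atTop,
      Integrable (MPIC.lossGap (π n) (MPIC.cols (X n) j) (w n))
        (MPIC.pairLaw (MPIC.cols (X n) j * Θ n) (St n)) ∧
      |MPIC.bias (π n) (MPIC.cols (X n) j) (w n) (MPIC.cols (X n) j * Θ n) (St n)
        - (n : ℝ) * (p n : ℝ) * (2 * (j.card : ℝ) + (p n : ℝ) + 1)
          / ((n : ℝ) - (p n : ℝ) - (j.card : ℝ) - 1)| ≤ p n * ε n by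
    obtain ⟨ε, hε, h⟩ := h
    refine ⟨h.mono fun n hn => hn.1, isLittleO_iff.mpr fun a ha => ?_⟩
    filter_upwards [h, hε.eventually_le_const ha] with n hn hεn
    rw [Real.norm_eq_abs, Real.norm_of_nonneg (Nat.cast_nonneg _), mul_comm a]
    exact hn.2.trans (by gcongr)
  rcases j.eq_empty_or_nonempty with hempty | hne
  -- without regressors the remainder vanishes
  · have : IsEmpty j := Finset.isEmpty_coe_sort.mpr hempty
    refine ⟨fun _ => 0, tendsto_const_nhds, hdim.mono fun n hn => ?_⟩
    obtain ⟨h1, h2⟩ := MPIC.bias_eq_of_isEmpty (hπ n) (hscale n) (X := MPIC.cols (X n) j)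
      (by simpa only [Fintype.card_fin, Fintype.card_coe] using hn.1) (hw n).1 (hw n).2 (Θ n) (hSt n)
    simp only [Fintype.card_fin, Fintype.card_coe] at h2
    exact ⟨h1, by rw [h2, sub_self, abs_zero, mul_zero]⟩
  obtain ⟨δ, hδ, hδ'⟩ := EReal.lt_iff_exists_real_btwn.mp hdet
  have hδ0 : 0 < δ := by exact_mod_cast hδ
  obtain ⟨ℓ, C, hℓ, hbound⟩ := MPIC.exists_bound_of_weightCondition hw hweight
  set A : ℝ := max C 1 * (2 * Real.pi) ^ ((j.card : ℝ) / 2) * δ ^ (-(1 / 2) : ℝ) with hA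
  have hA0 : 0 < A := by positivity
  set L : ℕ → ℝ := fun n => -Real.log (A * ℓ n ^ (-((j.card : ℝ) / 2))) with hLdef
  have hL : Tendsto L atTop atTop := MPIC.tendsto_neg_log_rate hℓ hne.card_pos A hA0
  refine ⟨_, MPIC.tendsto_remainder hL (32 * (MPIC.gaussFour * (j.card : ℝ) ^ 2) * B), ?_⟩
  filter_upwards [hdim, eventually_lt_of_lt_liminf hδ', hℓ.eventually_gt_atTop 0,
    hL.eventually_gt_atTop 0, eventually_gt_atTop 0] with n ⟨hdim1, hdim2⟩ hdetn hℓn hLn hn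
  have hdetn' : δ < (n : ℝ)⁻¹ ^ j.card * ((MPIC.cols (X n) j)ᵀ * MPIC.cols (X n) j).det := by
    have h : δ < ((n : ℝ)⁻¹ • ((MPIC.cols (X n) j)ᵀ * MPIC.cols (X n) j)).det := by
      exact_mod_cast hdetn
    rwa [Matrix.det_smul, Fintype.card_coe] at h
  have hdet0 : ((MPIC.cols (X n) j)ᵀ * MPIC.cols (X n) j).det ≠ 0 := fun h0 => by
    rw [h0, mul_zero] at hdetn'
    linarith
  obtain ⟨c, hc0, hc, hcC⟩ := hbound n hn hℓn
  rw [Fintype.card_coe] at hcC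
  have ha := MPIC.relative_weight_le hn (hp n) (hw n).1 (hw n).2 hℓn hδ0 hdetn' hc0 hcC
  have hp1 : (1 : ℝ) ≤ p n := by exact_mod_cast hp n
  have hexp : (A * ℓ n ^ (-((j.card : ℝ) / 2))) ^ p n = Real.exp (-(p n * L n)) := by
    rw [hLdef, mul_neg, neg_neg, Real.exp_nat_mul, Real.exp_log (by positivity)]
  rw [← hA, hexp] at ha
  obtain ⟨h1, h2⟩ := MPIC.abs_bias_sub_le_of_le_exp (hπ n) (hscale n) hc hdet0
    (by simpa using hdim1) (hw n).1 (hw n).2 (Θ n) (hSt n) (b := p n * L n) (by positivity)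
    (by simpa using ha)
  simp only [Fintype.card_fin, Fintype.card_coe] at h2
  have hG := MPIC.gaussFour_nonneg
  exact ⟨h1, h2.trans (MPIC.remainder_le hLn hp1 (by positivity) hB0 hdim2)⟩
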